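/- For a nonzero polynomial $A\in\mathbb F_2[x]$ let $\sigma(A)$ denote the sum of all divisors of $A$ in $\mathbb F_2[x]$. A \emph{Mersenne prime} over $\mathbb F_2$ is an irreducible polynomial of the form $1+x^a(x+1)^b$ with positive integers $a,b$. For $S\in\mathbb F_2[x]$ put $\overline S(x)=S(x+1)$. Let $M_j=1+x(x+1)^j$ for $j\in\{1,2,3\}$, and let $\mathcal M=\{M_1,M_2,\overline{M_2},M_3,\overline{M_3}\}$. For an odd prime number $p$ let $\mathrm{ord}_p(2)$ be the multiplicative order of $2$ modulo $p$. Theorem. Let $h$ be a positive integer and let $M\in\mathbb F_2[x]$ be a Mersenne prime. In each of the following cases, $\sigma(M^{2h})$ is divisible by an irreducible polynomial that is not a Mersenne prime: (i) $M\in\{M_1,M_3,\overline{M_3}\}$, or $M\in\{M_2,\overline{M_2}\}$ and $h\ge 2$; (ii) $M\notin\mathcal M$, and $2h+1$ has a prime divisor $p$ such that either $p\neq 7$ and $p=2^m-1$ for some integer $m\ge 1$, or $8$ divides $\mathrm{ord}_p(2)$. Moreover, $8$ divides $\mathrm{ord}_p(2)$ for every Fermat prime $p=2^{2^k}+1>5$,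 so that case (ii) applies in particular whenever $2h+1$ is divisible by such a prime. -/

import Mathlib

open Polynomial

namespace F2Poly

/-- A nonzero polynomial over `F_2` has only finitely many divisors, so that the sum defining
`sigma` below is a genuine finite sum. -/
theorem finite_divisors {A : (ZMod 2)[X]} (hA : A ≠ 0) : {D : (ZMod 2)[X] | D ∣ A}.Finite := by
  have h : Finite (degreeLT (ZMod 2) (A.natDegree + 1)) :=
    Finite.of_equiv _ (degreeLTEquiv (ZMod 2) (A.natDegree + 1)).toEquiv.symm
  refine (Set.toFinite (degreeLT (ZMod 2) (A.natDegree + 1) : Set (ZMod 2)[X])).subset ?_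
  intro D hD
  have hd : D.natDegree ≤ A.natDegree := natDegree_le_of_dvd hD hA
  refine mem_degreeLT.mpr (lt_of_le_of_lt degree_le_natDegree ?_)
  exact_mod_cast Nat.lt_succ_of_le hd

/-- `σ(A)`: the sum of all divisors of the (nonzero) polynomial `A ∈ F_2[x]`. -/
noncomputable def sigma (A : (ZMod 2)[X]) : (ZMod 2)[X] :=
  ∑ᶠ D ∈ {D : (ZMod 2)[X] | D ∣ A}, D

/-- A Mersenne prime over `F_2`: an irreducible polynomial of the form `1 + x^a (x+1)^b` with
positive integers `a`, `b`. -/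
def IsMersennePrime (P : (ZMod 2)[X]) : Prop :=
  Irreducible P ∧ ∃ a b : ℕ, 0 < a ∧ 0 < b ∧ P = 1 + X ^ a * (X + 1) ^ b

/-- The polynomial `M_j = 1 + x (x+1)^j`. -/
noncomputable def mersennePoly (j : ℕ) : (ZMod 2)[X] := 1 + X * (X + 1) ^ j

/-- The conjugate `S(x+1)` of a polynomial `S(x)`. -/
noncomputable def bar (S : (ZMod 2)[X]) : (ZMod 2)[X] := S.comp (X + 1)

/-- The set `{M_1, M_2, bar M_2, M_3, bar M_3}` of small Mersenne primes. -/
def smallMersenne : Set (ZMod 2)[X] :=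
  {mersennePoly 1, mersennePoly 2, bar (mersennePoly 2), mersennePoly 3, bar (mersennePoly 3)}

/-- `A` is divisible by a non Mersenne prime: it has an irreducible divisor which is not a
Mersenne prime. -/
def HasNonMersennePrimeFactor (A : (ZMod 2)[X]) : Prop :=
  ∃ Q : (ZMod 2)[X], Irreducible Q ∧ Q ∣ A ∧ ¬ IsMersennePrime Q

end F2Poly

/-!
For a Mersenne prime `M = 1 + u`, `u = x^a (x+1)^b`, the sum of divisors `σ (M ^ (2h))` is
`1 + M + ⋯ + M ^ (2h)` (`sigma_pow`), which is squarefree (`squarefree_geom`) and is divisible by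
`1 + M + ⋯ + M ^ (p - 1)` for each prime `p ∣ 2h + 1`. An irreducible factor `P` of the latter sees `M` as
a `p`-th root of unity, so `p ∣ 2 ^ deg P - 1` (`dvd_two_pow_natDegree_sub_one`). Three ideas then produce
a factor that is not a Mersenne prime.

* If `8` divides the order of `2` modulo `p`, every factor has degree divisible by `8`, while by a case of
  Swan's theorem no polynomial `1 + x^a (x+1)^b` with `8 ∣ a + b` is irreducible
  (`not_irreducible_of_eight_dvd`). It is proved with Witt vectors: Frobenius is an odd permutation of the
  lifted roots, although the discriminant is `≡ 1 mod 8`.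
* If `p = 2 ^ m - 1`, every irreducible polynomial of degree `m` other than `M` is a factor
  (`dvd_geom_of_natDegree_eq`), and for `m ≥ 5` not all of them are Mersenne primes
  (`exists_irreducible_not_mersenne`).
* Otherwise, suppose that all factors are Mersenne primes and compare the expansions at infinity of both
  sides of `W = ∏ Pⱼ`, that is, the reversed polynomials modulo `x ^ k` with `k ≤ 8`. A factor of degree at
  least `k` contributes only a power of `1 + x`, and there are very few factors of smaller degree
  (`exists_expansion`). The left hand side is known (`reverse_geom`), and the resulting congruences modulo
  `x ^ k` are impossible. This settles `p = 3` and the small Mersenne primes `M₁`, `M₂`, `M₃`; for `M₂` it is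
  applied to suitable divisors of `W` when `p = 7` and when `9 ∣ 2h + 1`.
-/

namespace F2Poly

/-! ### The discriminant of `1 + x^a (x+1)^b` and Frobenius on Witt vectors -/

open Matrix in
/-- The square of the Vandermonde determinant is the discriminant `∏ F'(rᵢ)` of `F = ∏ (X - rⱼ)`,
without a sign because `n (n - 1) / 2` is even. -/
theorem sq_det_vandermonde_eq_prod_derivative {R : Type*} [CommRing R] {n : ℕ} (hn : 4 ∣ n)
    (r : Fin n → R) :
    (vandermonde r).det ^ 2 =
      ∏ i, (derivative (∏ j, (X - C (r j)))).eval (r i) := by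
  have hd : ∀ i, (derivative (∏ j, (X - C (r j)))).eval (r i) = ∏ j ∈ ({i} : Finset (Fin n))ᶜ, (r i - r j) := by
    intro i
    rw [derivative_prod_finset, eval_finsetSum, Finset.sum_eq_single i]
    · simp [eval_prod, Finset.compl_singleton]
    · intro j _ hj
      simp only [eval_mul, eval_prod]
      rw [Finset.prod_eq_zero (i := i)] <;> simp [hj.symm]
    · simp
  have hs : ∏ i : Fin n, ∏ _j ∈ Finset.Ioi i, (-1 : R) = 1 := by
    simp only [Finset.prod_const, Fin.card_Ioi]
    rw [Finset.prod_pow_eq_pow_sum]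
    refine Even.neg_one_pow ?_
    have h1 : ∑ i : Fin n, (n - 1 - (i : ℕ)) = ∑ i ∈ Finset.range n, i := by
      rw [Fin.sum_univ_eq_sum_range (fun i => n - 1 - i) n]
      exact Finset.sum_range_reflect (fun i => i) n
    rw [h1]
    have h2 := Finset.sum_range_id_mul_two n
    obtain ⟨k, rfl⟩ := hn
    refine ⟨k * (4 * k - 1), ?_⟩
    have : (∑ i ∈ Finset.range (4 * k), i) * 2 = (k * (4 * k - 1) + k * (4 * k - 1)) * 2 := by
      rw [h2]; ring
    omega
  simp_rw [hd]
  rw [← Finset.prod_prod_Ioi_mul_eq_prod_prod_off_diag (fun i j => r j - r i), det_vandermonde, sq,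
    ← Finset.prod_mul_distrib]
  conv_lhs => rw [← one_mul (∏ i, _), ← hs, ← Finset.prod_mul_distrib]
  refine Finset.prod_congr rfl fun i _ => ?_
  rw [← Finset.prod_mul_distrib, ← Finset.prod_mul_distrib]
  exact Finset.prod_congr rfl fun j _ => by ring

open Matrix in
/-- An endomorphism permuting `α, φ α, …, φ^(n-1) α` cyclically, with `n` even, acts on them as an odd
permutation and so changes the sign of the Vandermonde determinant. -/
theorem map_det_vandermonde_of_cyclic {R : Type*} [CommRing R] (φ : R →+* R) (α : R) {n : ℕ}
    (hn : Even n) (hn0 : 0 < n) (h : φ^[n] α = α) :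
    φ (vandermonde fun i : Fin n => φ^[i] α).det = -(vandermonde fun i : Fin n => φ^[i] α).det := by
  obtain ⟨m, rfl⟩ : ∃ m, n = m + 1 := ⟨n - 1, by omega⟩
  have h2 : φ.mapMatrix (vandermonde fun i : Fin (m + 1) => φ^[i] α)
      = (vandermonde fun i : Fin (m + 1) => φ^[i] α).submatrix (finRotate (m + 1)) id := by
    ext i j
    simp only [RingHom.mapMatrix_apply, map_apply, vandermonde_apply, map_pow, submatrix_apply, id]
    congr 1
    rw [← Function.iterate_succ_apply' φ]
    rcases Fin.eq_castSucc_or_eq_last i with ⟨k, rfl⟩ | rfl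
    · simp
    · simpa using h
  have hodd : Odd m := by
    rcases Nat.even_or_odd m with h' | h'
    · exact absurd hn (by simpa [Nat.even_add_one] using h')
    · exact h'
  rw [RingHom.map_det, h2, det_permute, sign_finRotate]
  simp [hodd.neg_one_pow]

/-- Let `δ` be a square root of an element `≡ 1 mod 8`. Writing `δ = 1 + 2 e`, one has
`e ^ 2 + e ≡ 0 mod 2`, whereas `φ δ = -δ` would give `e ^ 2 ≡ φ e ≡ 1 + e mod 2`. -/
theorem frobenius_ne_neg_of_sq_eq {K : Type*} [Field K] [CharP K 2] [PerfectRing K 2] (δ c : WittVector 2 K)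
    (h : δ ^ 2 = 1 + 8 * c) : WittVector.frobenius δ ≠ -δ := by
  intro hφ
  have h2 : (2 : WittVector 2 K) ≠ 0 := by
    exact_mod_cast WittVector.p_nonzero 2 K
  have hco : ∀ x : WittVector 2 K, x.coeff 0 = 0 ↔ (2 : WittVector 2 K) ∣ x := by
    intro x
    rw [← WittVector.mem_span_p_iff_coeff_zero_eq_zero, Ideal.mem_span_singleton]
    norm_num
  have hc0 : ∀ x : WittVector 2 K, WittVector.constantCoeff x = x.coeff 0 := fun x => rfl
  have h20 : (2 : K) = 0 := CharTwo.two_eq_zero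
  obtain ⟨e, he⟩ : (2 : WittVector 2 K) ∣ δ - 1 := by
    rw [← hco, ← hc0]
    have := congrArg WittVector.constantCoeff h
    simp only [map_pow, map_add, map_mul, map_one, map_ofNat] at this
    have h' : (WittVector.constantCoeff δ - 1) ^ 2 = 0 := by
      linear_combination this + (4 * WittVector.constantCoeff c + 1 - WittVector.constantCoeff δ) * h20
    rw [map_sub, map_one]
    exact pow_eq_zero_iff (two_ne_zero) |>.mp h'
  have hδ : δ = 1 + 2 * e := by linear_combination he
  have h3 : e ^ 2 + e = 2 * c := by
    refine mul_left_cancel₀ h2 (mul_left_cancel₀ h2 ?_)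
    rw [hδ] at h
    linear_combination h
  have h4 : WittVector.frobenius e = -1 - e := by
    refine mul_left_cancel₀ h2 ?_
    rw [hδ] at hφ
    simp only [map_add, map_mul, map_one, map_ofNat] at hφ
    linear_combination hφ
  have h5 := congrArg WittVector.constantCoeff h3
  have h6 := congrArg WittVector.constantCoeff h4
  simp only [map_pow, map_add, map_sub, map_neg, map_mul, map_one, map_ofNat] at h5 h6
  rw [hc0 (WittVector.frobenius e), WittVector.coeff_frobenius_charP, ← hc0] at h6
  have : (1 : K) = 0 := by linear_combination h6 - h5 - (WittVector.constantCoeff c) * h20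
  exact one_ne_zero this

/-- With both exponents even the polynomial is a square. -/
theorem exponents_not_even {a b : ℕ} (hP : Irreducible (1 + X ^ a * (X + 1) ^ b : (ZMod 2)[X])) :
    ¬ (Even a ∧ Even b) := by
  rintro ⟨⟨c, rfl⟩, ⟨d, rfl⟩⟩
  have h : (1 + X ^ (c + c) * (X + 1) ^ (d + d) : (ZMod 2)[X]) = (1 + X ^ c * (X + 1) ^ d) ^ 2 := by
    rw [CharTwo.add_sq]; ring
  rw [h] at hP
  exact not_irreducible_pow (by norm_num) hP

theorem monic_mersenne {R : Type*} [CommRing R] [Nontrivial R] {a b : ℕ} (hab : 0 < a + b) :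
    (1 + X ^ a * (X + 1) ^ b : R[X]).Monic ∧ (1 + X ^ a * (X + 1) ^ b : R[X]).natDegree = a + b := by
  have h1 : (X ^ a * (X + 1) ^ b : R[X]).Monic := (monic_X_pow a).mul ((monic_X_add_C (1 : R)).pow b)
  have h2 : (X ^ a * (X + 1) ^ b : R[X]).natDegree = a + b := by
    have := (monic_X_pow (R := R) a).natDegree_mul ((monic_X_add_C (1 : R)).pow b)
    rw [natDegree_X_pow, (monic_X_add_C (1 : R)).natDegree_pow, natDegree_X_add_C, mul_one] at this
    exact this
  have h3 : (1 : R[X]).degree < (X ^ a * (X + 1) ^ b : R[X]).degree := by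
    rw [degree_eq_natDegree h1.ne_zero, h2, degree_one]
    exact_mod_cast hab
  constructor
  · exact Monic.add_of_right h1 h3
  · rw [natDegree_add_eq_right_of_degree_lt h3, h2]

theorem derivative_mersenne {R : Type*} [CommRing R] {a b : ℕ} (ha : 0 < a) (hb : 0 < b) :
    derivative (1 + X ^ a * (X + 1) ^ b : R[X]) =
      X ^ (a - 1) * (X + 1) ^ (b - 1) * (((a + b : ℕ) : R[X]) * X + (a : R[X])) := by
  obtain ⟨a, rfl⟩ : ∃ m, a = m + 1 := ⟨a - 1, by omega⟩
  obtain ⟨b, rfl⟩ : ∃ m, b = m + 1 := ⟨b - 1, by omega⟩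
  simp [derivative_pow]
  ring

/-- If `8 ∣ a + b` and `a` is odd, the discriminant of `1 + x^a (x+1)^b` is `≡ 1 mod 8`: its derivative is
`x^(a-1) (x+1)^(b-1) ((a+b) x + a)`, and both `∏ rᵢ` and `∏ (rᵢ + 1)` equal `1`. -/
theorem exists_sq_det_vandermonde_eq {R : Type*} [CommRing R] [IsDomain R] {a b : ℕ} (ha : 0 < a)
    (hb : 0 < b) (hoa : Odd a) (h8 : 8 ∣ a + b) (r : Fin (a + b) → R) (hrinj : Function.Injective r)
    (hr : ∀ i, (1 + X ^ a * (X + 1) ^ b : R[X]).IsRoot (r i)) :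
    ∃ c, (Matrix.vandermonde r).det ^ 2 = 1 + 8 * c := by
  have hev : Even (a + b) := Nat.even_iff.mpr (by omega)
  obtain ⟨hFm, hFn⟩ := monic_mersenne (R := R) (a := a) (b := b) (by omega)
  have hprod : (1 + X ^ a * (X + 1) ^ b : R[X]) = ∏ j, (X - C (r j)) := by
    refine eq_of_monic_of_dvd_of_natDegree_le (monic_prod_of_monic _ _ fun i _ => monic_X_sub_C _) hFm ?_ ?_
    · have h1 : Finset.univ.val.map r ≤ (1 + X ^ a * (X + 1) ^ b : R[X]).roots := by
        rw [Multiset.le_iff_subset (Finset.univ.nodup.map hrinj)]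
        intro x hx
        obtain ⟨i, -, rfl⟩ := Multiset.mem_map.mp hx
        exact (mem_roots hFm.ne_zero).mpr (hr i)
      have h2 := (Multiset.prod_X_sub_C_dvd_iff_le_roots hFm.ne_zero _).mpr h1
      rwa [Multiset.map_map] at h2
    · rw [natDegree_prod_of_monic _ _ fun i _ => monic_X_sub_C _, hFn]
      simp
  have hsq := sq_det_vandermonde_eq_prod_derivative (by omega) r
  rw [← hprod, derivative_mersenne ha hb] at hsq
  have hp0 : ∏ i, r i = 1 := by
    have := congrArg (eval 0) hprod
    simpa [ha.ne', eval_prod, Finset.prod_neg, hev.neg_one_pow] using this.symm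
  have hp1 : ∏ i, (r i + 1) = 1 := by
    have := congrArg (eval (-1)) hprod
    have h1 : ∀ i, -1 - r i = -(r i + 1) := fun i => by ring
    simp only [eval_prod, eval_sub, eval_X, eval_C, h1, Finset.prod_neg, Finset.card_univ,
      Fintype.card_fin, hev.neg_one_pow, one_mul] at this
    simpa [hb.ne'] using this.symm
  simp only [eval_mul, eval_pow, eval_X, eval_add, eval_one, eval_natCast, Finset.prod_mul_distrib,
    Finset.prod_pow, hp0, hp1, one_pow, one_mul] at hsq
  have h8c : (8 : R) ∣ ∏ i, ((a + b : ℕ) * r i + (a : R)) - 1 := by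
    obtain ⟨k, hk⟩ := h8
    obtain ⟨l, hl⟩ := hev
    have ha2 : ((8 : ℤ) : R) ∣ ((a : ℤ) ^ 2 - 1 : ℤ) :=
      Int.cast_dvd_cast _ _ (Int.eight_dvd_sq_sub_one_of_odd (by exact_mod_cast hoa))
    rw [← Ideal.mem_span_singleton, ← Ideal.Quotient.eq_zero_iff_mem]
    have h80 : (Ideal.Quotient.mk (Ideal.span {(8 : R)})) 8 = 0 :=
      Ideal.Quotient.eq_zero_iff_mem.mpr (Ideal.mem_span_singleton_self _)
    have ha3 : (Ideal.Quotient.mk (Ideal.span {(8 : R)})) a ^ 2 = 1 := by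
      rw [← sub_eq_zero, ← map_one (Ideal.Quotient.mk (Ideal.span {(8 : R)})), ← map_pow, ← map_sub,
        Ideal.Quotient.eq_zero_iff_mem, Ideal.mem_span_singleton]
      exact_mod_cast ha2
    have hk' : ((a + b : ℕ) : R) = 8 * (k : R) := by rw [hk]; push_cast; ring
    simp only [map_sub, map_prod, map_add, map_mul, hk', h80, zero_mul, zero_add, Finset.prod_const,
      Finset.card_univ, Fintype.card_fin, map_one]
    rw [hl, ← two_mul, pow_mul, ha3, one_pow, sub_self]
  obtain ⟨c, hc⟩ := h8c
  exact ⟨c, by rw [hsq]; linear_combination hc⟩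

/-- A case of Swan's theorem. If the polynomial were irreducible of degree `n`, its roots would lift to
`WittVector 2 K`, with `K` the field of `2 ^ n` elements, where Frobenius permutes them in an `n`-cycle; but the
Vandermonde determinant of the lifted roots squares to `1 mod 8`, so Frobenius cannot change its sign. -/
theorem not_irreducible_of_eight_dvd {a b : ℕ} (ha : 0 < a) (hb : 0 < b) (h8 : 8 ∣ a + b) :
    ¬ Irreducible (1 + X ^ a * (X + 1) ^ b : (ZMod 2)[X]) := by
  intro hP
  have hev := exponents_not_even hP
  have hev' : Even (a + b) := (Nat.even_iff.mpr (by omega))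
  have hoa : Odd a := by
    rw [Nat.even_add] at hev'
    by_contra h
    rw [Nat.not_odd_iff_even] at h
    tauto
  have hob : Odd b := by
    rw [Nat.even_add] at hev'
    by_contra h
    rw [Nat.not_odd_iff_even] at h
    tauto
  set P : (ZMod 2)[X] := 1 + X ^ a * (X + 1) ^ b with hPdef
  set n := a + b with hn
  obtain ⟨hPm, hPn⟩ := monic_mersenne (R := ZMod 2) (a := a) (b := b) (by omega)
  rw [← hPdef] at hPm hPn
  have : Fact (Irreducible P) := ⟨hP⟩
  let K := AdjoinRoot P
  let : Field K := AdjoinRoot.instField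
  have : Module.Finite (ZMod 2) K := (AdjoinRoot.powerBasis hP.ne_zero).finite
  have : Finite K := Module.finite_of_finite (ZMod 2)
  have : CharP K 2 := charP_of_injective_algebraMap (algebraMap (ZMod 2) K).injective 2
  have hcard : Nat.card K = 2 ^ n := by
    rw [Module.natCard_eq_pow_finrank (K := ZMod 2), (AdjoinRoot.powerBasis hP.ne_zero).finrank,
      AdjoinRoot.powerBasis_dim, hPn, hn]
    simp
  set α₀ : K := AdjoinRoot.root P with hα₀
  have hroot : 1 + α₀ ^ a * (α₀ + 1) ^ b = 0 := by
    have := AdjoinRoot.mk_self (f := P)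
    rw [hPdef] at this
    simpa only [map_add, map_mul, map_pow, map_one, AdjoinRoot.mk_X] using this
  have hα0 : α₀ ≠ 0 := by rintro h; simp [h, ha.ne'] at hroot
  have hα1 : α₀ + 1 ≠ 0 := by rintro h; simp [h, hb.ne'] at hroot
  let π : WittVector 2 K →+* K := WittVector.constantCoeff
  have hπ : ∀ x, π x = x.coeff 0 := fun _ => rfl
  set F : (WittVector 2 K)[X] := 1 + X ^ a * (X + 1) ^ b with hF
  obtain ⟨hFm, hFn⟩ := monic_mersenne (R := WittVector 2 K) (a := a) (b := b) (by omega)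
  obtain ⟨y, hy⟩ := WittVector.constantCoeff_surjective 2 α₀
  -- `WittVector 2 K` is complete, so the simple root of the reduction lifts
  obtain ⟨α, hα, hαy⟩ := HenselianRing.is_henselian (I := Ideal.span {((2 : ℕ) : WittVector 2 K)}) F hFm y (by
      rw [WittVector.mem_span_p_iff_coeff_zero_eq_zero, ← hπ]
      have : π y = α₀ := hy
      simp [hF, this, hroot]) (by
      refine IsUnit.map _ (WittVector.isUnit_of_coeff_zero_ne_zero _ ?_)
      rw [← hπ, hF, derivative_mersenne ha hb]
      have : π y = α₀ := hy
      have h2 : ((a + b : ℕ) : K) = 0 := (CharP.cast_eq_zero_iff K 2 _).mpr (by omega)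
      have h3 : (a : K) ≠ 0 := by
        rw [Ne, CharP.cast_eq_zero_iff K 2]
        rw [← even_iff_two_dvd, Nat.not_even_iff_odd]; exact hoa
      simp only [eval_mul, eval_pow, eval_X, eval_add, eval_one, eval_natCast, map_mul, map_pow, this,
        map_add, map_one, map_natCast, h2, zero_mul, zero_add]
      exact mul_ne_zero (mul_ne_zero (pow_ne_zero _ hα0) (pow_ne_zero _ hα1)) h3)
  have hπα : π α = α₀ := by
    rw [WittVector.mem_span_p_iff_coeff_zero_eq_zero, ← hπ, map_sub, sub_eq_zero] at hαy
    rw [hαy]; exact hy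
  let φ : WittVector 2 K →+* WittVector 2 K := WittVector.frobenius
  have hφc : ∀ i x k, (φ^[i] x).coeff k = x.coeff k ^ 2 ^ i := by
    intro i
    induction i with
    | zero => simp
    | succ i ih =>
      intro x k
      rw [Function.iterate_succ_apply', WittVector.coeff_frobenius_charP, ih, ← pow_mul, pow_succ]
  have hφn : φ^[n] α = α := by
    ext k
    have := Fintype.ofFinite K
    rw [hφc, ← hcard, Nat.card_eq_fintype_card, FiniteField.pow_card]
  have hFr : ∀ i, F.eval (φ^[i] α) = 0 := by
    intro i
    induction i with
    | zero => exact hα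
    | succ i ih =>
      rw [Function.iterate_succ_apply']
      have := congrArg φ ih
      simpa [hF] using this
  set r : Fin n → WittVector 2 K := fun i => φ^[i] α with hr
  have hπr : ∀ i : ℕ, π (φ^[i] α) = α₀ ^ 2 ^ i := by
    intro i; rw [hπ, hφc, ← hπ, hπα]
  have hrinj : Function.Injective r := by
    have key : ∀ i j : ℕ, i < j → j < n → φ^[i] α ≠ φ^[j] α := by
      intro i j hij hj h
      have h1 : α₀ ^ 2 ^ i = α₀ ^ 2 ^ j := by rw [← hπr, ← hπr, h]
      obtain ⟨k, rfl⟩ := Nat.exists_eq_add_of_lt hij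
      have h2 : α₀ = α₀ ^ 2 ^ (k + 1) := by
        apply iterateFrobenius_inj K 2 i
        rw [iterateFrobenius_def, iterateFrobenius_def, h1, ← pow_mul, ← pow_add]
        congr 2; ring
      have h3 : P ∣ X ^ (Nat.card (ZMod 2)) ^ (k + 1) - X := by
        rw [← AdjoinRoot.mk_eq_zero]
        simp only [Nat.card_zmod, map_sub, map_pow, AdjoinRoot.mk_X]
        rw [sub_eq_zero]; exact h2.symm
      have h4 := hP.natDegree_dvd_of_dvd_X_pow_card_pow_sub_X h3
      rw [hPn] at h4
      have := Nat.le_of_dvd (by omega) h4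
      omega
    intro i j hij
    rcases lt_trichotomy (i : ℕ) j with h | h | h
    · exact absurd hij (key _ _ h j.2)
    · exact Fin.ext h
    · exact absurd hij.symm (key _ _ h i.2)
  obtain ⟨c, hc⟩ := exists_sq_det_vandermonde_eq ha hb hoa h8 r hrinj fun i => hFr i
  exact frobenius_ne_neg_of_sq_eq _ c hc (map_det_vandermonde_of_cyclic φ α (n := n) hev' (by omega) hφn)

/-! ### Sums of divisors, orders modulo irreducible factors, squarefreeness -/

theorem monic_of_ne_zero {A : (ZMod 2)[X]} (hA : A ≠ 0) : A.Monic := by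
  have h : A.leadingCoeff ≠ 0 := leadingCoeff_ne_zero.mpr hA
  generalize hc : A.leadingCoeff = c at h
  rw [Monic, hc]
  revert h; clear hc; revert c; decide

theorem eq_of_associated {A B : (ZMod 2)[X]} (hA : A ≠ 0) (h : Associated A B) : A = B :=
  eq_of_monic_of_associated (monic_of_ne_zero hA) (monic_of_ne_zero (h.ne_zero_iff.mp hA)) h

theorem eq_of_irreducible_of_dvd {P Q : (ZMod 2)[X]} (hP : Irreducible P) (hQ : Irreducible Q)
    (h : P ∣ Q) : P = Q :=
  eq_of_associated hP.ne_zero (hP.associated_of_dvd hQ h)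

/-- All units of `𝔽₂[x]` are trivial, so the divisors of `M ^ n` are exactly the powers of `M`. -/
theorem sigma_pow {M : (ZMod 2)[X]} (hM : Irreducible M) (n : ℕ) :
    sigma (M ^ n) = ∑ i ∈ Finset.range (n + 1), M ^ i := by
  classical
  have hinj : Function.Injective fun i : ℕ => M ^ i := by
    intro i j h
    have := congrArg natDegree h
    simp only [natDegree_pow] at this
    exact Nat.eq_of_mul_eq_mul_right hM.natDegree_pos this
  have hset : {D : (ZMod 2)[X] | D ∣ M ^ n} = ((Finset.range (n + 1)).image fun i => M ^ i : Finset _) := by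
    ext D
    simp only [Set.mem_ofPred_eq, Finset.coe_image, Set.mem_image, Finset.coe_range, Set.mem_Iio]
    rw [dvd_prime_pow hM.prime]
    constructor
    · rintro ⟨i, hi, h⟩
      exact ⟨i, by omega, (eq_of_associated (pow_ne_zero _ hM.ne_zero) h.symm)⟩
    · rintro ⟨i, hi, rfl⟩
      exact ⟨i, by omega, Associated.refl _⟩
  rw [sigma, hset, finsum_mem_coe_finset, Finset.sum_image fun i _ j _ h => hinj h]

/-- Fermat's little theorem in the residue field `𝔽₂[x] / (P)`. -/
theorem dvd_pow_two_pow_natDegree_sub {P : (ZMod 2)[X]} (hP : Irreducible P) (A : (ZMod 2)[X]) :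
    P ∣ A ^ 2 ^ P.natDegree - A := by
  have h := hP.natDegree_dvd_iff_dvd_X_pow_card_pow_sub_X.mp (dvd_refl P.natDegree)
  rw [Nat.card_zmod] at h
  have h2 : ∀ k, A ^ 2 ^ k = A.comp (X ^ 2 ^ k) := by
    intro k
    induction k with
    | zero => simp
    | succ k ih => rw [pow_succ, pow_mul, ih, ← ZMod.expand_card, expand_eq_comp_X_pow, comp_assoc,
        X_pow_comp, ← pow_mul, mul_comm 2]
  have h3 := sub_dvd_eval_sub (X ^ 2 ^ P.natDegree) X (A.map C)
  rw [eval_map, eval_map] at h3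
  rw [h2]
  have h4 : eval₂ C X A = A := eval₂_C_X
  rw [h4] at h3
  exact h.trans h3

/-- The sum `1 + M + ⋯ + M ^ (n - 1)`, which is `σ (M ^ (n - 1))` for irreducible `M`. -/
noncomputable def geom (n : ℕ) (M : (ZMod 2)[X]) : (ZMod 2)[X] := ∑ i ∈ Finset.range n, M ^ i

theorem geom_mul (n : ℕ) (M : (ZMod 2)[X]) : geom n M * (M - 1) = M ^ n - 1 := geom_sum_mul M n

theorem geom_dvd_geom {q n : ℕ} (h : q ∣ n) (M : (ZMod 2)[X]) : geom q M ∣ geom n M := by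
  obtain ⟨k, rfl⟩ := h
  induction k with
  | zero => simp [geom]
  | succ k ih =>
    rw [mul_add_one]
    unfold geom at ih ⊢
    rw [Finset.sum_range_add]
    simp only [pow_add, ← Finset.mul_sum]
    exact dvd_add ih (dvd_mul_left _ _)

theorem not_dvd_sub_one_of_dvd_geom {P M : (ZMod 2)[X]} {n : ℕ} (hn : Odd n) (hP : Irreducible P)
    (h : P ∣ geom n M) : ¬ P ∣ M - 1 := by
  intro h1
  have hg : M - 1 ∣ geom n M - 1 := by
    have h2 := sub_dvd_eval_sub M 1 (∑ i ∈ Finset.range n, (X : (ZMod 2)[X][X]) ^ i)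
    simp only [eval_finsetSum, eval_pow, eval_X, one_pow, Finset.sum_const, Finset.card_range,
      nsmul_eq_mul, mul_one] at h2
    have h3 : (n : (ZMod 2)[X]) = 1 := by
      obtain ⟨k, rfl⟩ := hn
      push_cast
      linear_combination (k : (ZMod 2)[X]) * (CharTwo.two_eq_zero : (2 : (ZMod 2)[X]) = 0)
    rwa [h3] at h2
  have h3 : P ∣ 1 := by
    have := dvd_sub h (h1.trans hg)
    simpa using this
  exact hP.not_isUnit (isUnit_of_dvd_one h3)

/-- If `M` has order `p ^ (k + 1)` modulo `P`, this order divides that of the multiplicative group of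
the residue field. -/
theorem dvd_two_pow_natDegree_sub_one_of_pow {P M : (ZMod 2)[X]} (hP : Irreducible P) {p : ℕ} (k : ℕ)
    (hp : p.Prime) (h : P ∣ M ^ p ^ (k + 1) - 1) (h1 : ¬ P ∣ M ^ p ^ k - 1) :
    p ^ (k + 1) ∣ 2 ^ P.natDegree - 1 := by
  have : Fact (Irreducible P) := ⟨hP⟩
  have : Fact p.Prime := ⟨hp⟩
  let := AdjoinRoot.instField (f := P)
  have e1 : (AdjoinRoot.mk P M) ^ p ^ (k + 1) = 1 := by
    rw [← sub_eq_zero, ← map_one (AdjoinRoot.mk P), ← map_pow, ← map_sub]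
    exact AdjoinRoot.mk_eq_zero.mpr h
  have e2 : (AdjoinRoot.mk P M) ^ p ^ k ≠ 1 := by
    rw [← sub_ne_zero, ← map_one (AdjoinRoot.mk P), ← map_pow, ← map_sub, Ne, AdjoinRoot.mk_eq_zero]
    exact h1
  have e3 := orderOf_eq_prime_pow e2 e1
  have e4 : AdjoinRoot.mk P M ≠ 0 := by
    intro h0
    rw [h0, zero_pow (pow_ne_zero _ hp.ne_zero)] at e1
    exact zero_ne_one e1
  rw [← e3, orderOf_dvd_iff_pow_eq_one]
  have e5 := dvd_pow_two_pow_natDegree_sub hP M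
  rw [← AdjoinRoot.mk_eq_zero, map_sub, map_pow, sub_eq_zero] at e5
  refine mul_right_cancel₀ e4 ?_
  rw [← pow_succ, Nat.sub_add_cancel Nat.one_le_two_pow, e5, one_mul]

theorem dvd_two_pow_natDegree_sub_one {P M : (ZMod 2)[X]} (hP : Irreducible P) {p : ℕ}
    (hp : p.Prime) (hp2 : p ≠ 2) (h : P ∣ geom p M) : p ∣ 2 ^ P.natDegree - 1 := by
  have := dvd_two_pow_natDegree_sub_one_of_pow (M := M) hP 0 hp ?_ ?_
  · simpa using this
  · rw [zero_add, pow_one, ← geom_mul]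
    exact h.mul_right _
  · rw [pow_zero, pow_one]
    exact not_dvd_sub_one_of_dvd_geom (hp.odd_of_ne_two hp2) hP h

/-- When `M` is neither `0` nor `1` modulo `P`, it is a nontrivial root of unity of order dividing
`2 ^ deg P - 1` there. -/
theorem dvd_geom_mersenne {P M : (ZMod 2)[X]} (hP : Irreducible P) (h0 : ¬ P ∣ M) (h1 : ¬ P ∣ M - 1) :
    P ∣ geom (2 ^ P.natDegree - 1) M := by
  have h2 : P ∣ geom (2 ^ P.natDegree - 1) M * (M - 1) * M := by
    rw [geom_mul, sub_mul, ← pow_succ, Nat.sub_add_cancel Nat.one_le_two_pow, one_mul]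
    exact dvd_pow_two_pow_natDegree_sub hP M
  rcases hP.prime.dvd_or_dvd h2 with h3 | h3
  · exact (hP.prime.dvd_or_dvd h3).resolve_right h1
  · exact absurd h3 h0

theorem eq_X_or_of_dvd {P : (ZMod 2)[X]} {a b : ℕ} (hP : Irreducible P) (h : P ∣ X ^ a * (X + 1) ^ b) :
    P = X ∨ P = X + 1 := by
  have hX1 : Irreducible (X + 1 : (ZMod 2)[X]) := irreducible_of_degree_eq_one (degree_X_add_C (1 : ZMod 2))
  rcases hP.prime.dvd_or_dvd h with h | h
  · exact .inl (eq_of_irreducible_of_dvd hP irreducible_X (hP.prime.dvd_of_dvd_pow h))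
  · exact .inr (eq_of_irreducible_of_dvd hP hX1 (hP.prime.dvd_of_dvd_pow h))

/-- A repeated irreducible factor of `geom n M` divides `M'`, hence `x (x + 1)`, hence `M - 1`; but
`geom n M` is congruent to `n`, which is odd, modulo `M - 1`. -/
theorem squarefree_geom {M : (ZMod 2)[X]} (hM : IsMersennePrime M) {n : ℕ} (hn : Odd n) :
    Squarefree (geom n M) := by
  obtain ⟨hMi, a, b, ha, hb, rfl⟩ := hM
  set M : (ZMod 2)[X] := 1 + X ^ a * (X + 1) ^ b with hMdef
  have hev := exponents_not_even hMi
  have hn1 : (n : (ZMod 2)[X]) = 1 := by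
    obtain ⟨k, rfl⟩ := hn
    push_cast
    linear_combination (k : (ZMod 2)[X]) * (CharTwo.two_eq_zero : (2 : (ZMod 2)[X]) = 0)
  have hu : M - 1 = X ^ a * (X + 1) ^ b := by rw [hMdef]; ring
  have hg0 : geom n M ≠ 0 := by
    intro h
    exact not_dvd_sub_one_of_dvd_geom (M := M) hn irreducible_X (h ▸ dvd_zero X)
      (hu ▸ (dvd_pow_self X ha.ne').mul_right _)
  rw [squarefree_iff_no_irreducibles hg0]
  intro P hP hPP
  have hPg : P ∣ geom n M := (dvd_mul_right P P).trans hPP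
  have hP1 := not_dvd_sub_one_of_dvd_geom hn hP hPg
  rw [hu] at hP1
  have hPX : P ≠ X := by
    rintro rfl; exact hP1 ((dvd_pow_self X ha.ne').mul_right _)
  have hPX1 : P ≠ X + 1 := by
    rintro rfl; exact hP1 ((dvd_pow_self (X + 1) hb.ne').mul_left _)
  have hPM : P ∣ M ^ n - 1 := geom_mul n M ▸ hPg.mul_right _
  have hPM0 : ¬ P ∣ M := by
    intro h
    have h2 := dvd_sub (h.trans (dvd_pow_self M hn.pos.ne')) hPM
    rw [sub_sub_cancel] at h2
    exact hP.not_isUnit (isUnit_of_dvd_one h2)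
  have hd : P ∣ derivative (M ^ n - 1) := by
    obtain ⟨c, hc⟩ := hPP
    rw [← geom_mul, hc]
    simp only [derivative_mul]
    refine ⟨(derivative P * c + derivative P * c + P * derivative c) * (M - 1)
      + P * c * derivative (M - 1), by ring⟩
  have hd2 : P ∣ derivative M := by
    rw [derivative_sub, derivative_one, sub_zero, derivative_pow, C_eq_natCast, hn1, one_mul] at hd
    exact (hP.prime.dvd_or_dvd hd).resolve_left fun h => hPM0 (hP.prime.dvd_of_dvd_pow h)
  rw [hMdef, derivative_mersenne ha hb] at hd2
  rcases hP.prime.dvd_or_dvd hd2 with h | h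
  · rcases eq_X_or_of_dvd hP h with h | h
    exacts [hPX h, hPX1 h]
  · have hc : ∀ m : ℕ, (m : (ZMod 2)[X]) = ((m % 2 : ℕ) : (ZMod 2)[X]) := by
      intro m
      conv_lhs => rw [← Nat.div_add_mod m 2]
      push_cast
      linear_combination ((m / 2 : ℕ) : (ZMod 2)[X]) * (CharTwo.two_eq_zero : (2 : (ZMod 2)[X]) = 0)
    rw [hc (a + b), hc a, Nat.add_mod] at h
    rw [Nat.even_iff, Nat.even_iff] at hev
    have h12 : (1 + 1) % 2 = 0 := rfl
    rcases Nat.mod_two_eq_zero_or_one a with ha' | ha' <;>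
      rcases Nat.mod_two_eq_zero_or_one b with hb' | hb' <;>
      simp only [ha', hb', h12, Nat.one_mod, Nat.cast_zero, Nat.cast_one, zero_mul,
        zero_add, one_mul, add_zero] at h
    · exact hev ⟨ha', hb'⟩
    · exact hPX (eq_of_irreducible_of_dvd hP irreducible_X h)
    · exact hPX1 ((eq_X_or_of_dvd (a := 0) (b := 1) hP (by simpa using h)).resolve_left hPX)
    · exact hP.not_isUnit (isUnit_of_dvd_one h)

/-! ### Expansion at infinity -/

theorem reverse_add_one (A : (ZMod 2)[X]) :
    (A + 1).reverse = A.reverse + X ^ A.natDegree := by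
  have h : (A + 1).natDegree = A.natDegree := by simpa using natDegree_add_C (p := A) (a := (1 : ZMod 2))
  rw [reverse, h, reflect_add, reflect_one, reverse]

theorem reverse_pow (A : (ZMod 2)[X]) (n : ℕ) : (A ^ n).reverse = A.reverse ^ n := by
  induction n with
  | zero => simpa using reverse_C (1 : ZMod 2)
  | succ n ih => rw [pow_succ, reverse_mul_of_domain, ih, pow_succ]

theorem natDegree_X_pow_mul (a b : ℕ) : (X ^ a * (X + 1) ^ b : (ZMod 2)[X]).natDegree = a + b := by
  have := (monic_X_pow (R := ZMod 2) a).natDegree_mul ((monic_X_add_C (1 : ZMod 2)).pow b)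
  rw [natDegree_X_pow, (monic_X_add_C (1 : ZMod 2)).natDegree_pow, natDegree_X_add_C, mul_one] at this
  exact this

theorem reverse_X_pow_mul_X_add_one_pow (a b : ℕ) : (X ^ a * (X + 1) ^ b : (ZMod 2)[X]).reverse = (1 + X) ^ b := by
  have h : (X + 1 : (ZMod 2)[X]).reverse = 1 + X := by
    rw [reverse_add_one]
    have h1 : (1 : (ZMod 2)[X]).reverse = 1 := by simpa using reverse_C (1 : ZMod 2)
    have : (X : (ZMod 2)[X]).reverse = 1 := by simpa [h1] using reverse_mul_X (1 : (ZMod 2)[X])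
    rw [this]; simp
  rw [reverse_X_pow_mul, reverse_pow, h]

theorem reverse_mersenne (a b : ℕ) :
    (1 + X ^ a * (X + 1) ^ b : (ZMod 2)[X]).reverse = (1 + X) ^ b + X ^ (a + b) := by
  rw [add_comm, reverse_add_one, reverse_X_pow_mul_X_add_one_pow, natDegree_X_pow_mul]

/-- The reverse of a Mersenne prime of degree `n` is `(1 + x)^b + x^n`, so a product of Mersenne primes of
degree at least `k` has reverse a power of `1 + x` modulo `x ^ k`. -/
theorem exists_reverse_of_large_factors {k : ℕ} (V : (ZMod 2)[X]) (hV : V ≠ 0)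
    (h : ∀ P, Irreducible P → P ∣ V → IsMersennePrime P ∧ k ≤ P.natDegree) :
    ∃ B, X ^ k ∣ V.reverse - (1 + X) ^ B := by
  induction V using UniqueFactorizationMonoid.induction_on_prime with
  | h₁ => exact absurd rfl hV
  | h₂ V hu =>
    refine ⟨0, ?_⟩
    have : V = 1 := eq_of_associated hV (associated_one_iff_isUnit.mpr hu)
    have h1 : (1 : (ZMod 2)[X]).reverse = 1 := by simpa using reverse_C (1 : ZMod 2)
    simp [this, h1]
  | h₃ A P hA hP ih =>
    obtain ⟨B, hB⟩ := ih hA fun Q hQ hQA => h Q hQ (hQA.mul_left _)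
    obtain ⟨⟨-, a, b, ha, hb, rfl⟩, hk⟩ := h P hP.irreducible (dvd_mul_right _ _)
    rw [(monic_mersenne (R := ZMod 2) (by omega : 0 < a + b)).2] at hk
    refine ⟨b + B, ?_⟩
    rw [reverse_mul_of_domain, reverse_mersenne]
    have h2 : X ^ k ∣ (X ^ (a + b) : (ZMod 2)[X]) := pow_dvd_pow _ hk
    have := dvd_add (hB.mul_left ((1 + X) ^ b)) (h2.mul_right A.reverse)
    convert this using 1
    ring

/-- Modulo `x ^ 8` the polynomial `1 + x` has order dividing `8`, so exponents may be moved across and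
reduced. -/
theorem exists_exponent_lt_eight {k A C : ℕ} (hk : k ≤ 8) {V V' : (ZMod 2)[X]}
    (h : X ^ k ∣ (1 + X) ^ A * V - (1 + X) ^ C * V') : ∃ E < 8, X ^ k ∣ (1 + X) ^ E * V - V' := by
  have h8 : ∀ m : ℕ, X ^ k ∣ ((1 + X) ^ (8 * m) - 1 : (ZMod 2)[X]) := by
    intro m
    have h1 : (1 + X : (ZMod 2)[X]) ^ 8 = 1 + X ^ 8 := by
      rw [show 8 = 2 ^ 3 by norm_num, add_pow_char_pow, one_pow]
    have h2 : (1 + X : (ZMod 2)[X]) ^ 8 - 1 ∣ ((1 + X) ^ 8) ^ m - 1 := sub_one_dvd_pow_sub_one _ _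
    rw [pow_mul]
    refine dvd_trans ?_ h2
    rw [h1, add_sub_cancel_left]
    exact pow_dvd_pow _ hk
  refine ⟨(A + 7 * C) % 8, Nat.mod_lt _ (by norm_num), ?_⟩
  have e : (1 + X : (ZMod 2)[X]) ^ (A + 7 * C)
      = (1 + X) ^ (8 * ((A + 7 * C) / 8)) * (1 + X) ^ ((A + 7 * C) % 8) := by
    rw [← pow_add, Nat.div_add_mod]
  have e2 : (1 + X : (ZMod 2)[X]) ^ (7 * C) * (1 + X) ^ C = (1 + X) ^ (8 * C) := by
    rw [← pow_add]; congr 1; ring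
  rw [pow_add] at e
  have h3 := (h.mul_left ((1 + X) ^ (7 * C)))
  have := dvd_add (dvd_sub h3 ((h8 ((A + 7 * C) / 8)).mul_right ((1 + X) ^ ((A + 7 * C) % 8) * V)))
    ((h8 C).mul_right V')
  convert this using 1
  linear_combination (-V') * e2 - V * e

/-- The comparison at infinity. If `W` is a squarefree product of Mersenne primes whose factors of degree
less than `k` all divide `A ∣ W`, then modulo `x ^ k` the reverses of `W` and `A` differ by a power of `1 + x`. -/
theorem exists_expansion {k C : ℕ} (hk : k ≤ 8) {W A R : (ZMod 2)[X]} (hW : Squarefree W) (hA : A ∣ W)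
    (hM : ∀ P, Irreducible P → P ∣ W → IsMersennePrime P)
    (hlarge : ∀ P, Irreducible P → P ∣ W → P ∣ A ∨ k ≤ P.natDegree)
    (hR : X ^ k ∣ W.reverse - (1 + X) ^ C * R) :
    ∃ E < 8, X ^ k ∣ (1 + X) ^ E * A.reverse - R := by
  obtain ⟨V, rfl⟩ := hA
  have hV : V ≠ 0 := right_ne_zero_of_mul hW.ne_zero
  obtain ⟨B, hB⟩ := exists_reverse_of_large_factors (k := k) V hV fun P hP hPV => by
    refine ⟨hM P hP (hPV.mul_left _), (hlarge P hP (hPV.mul_left _)).resolve_left fun h => ?_⟩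
    exact hP.not_isUnit (hW P (mul_dvd_mul h hPV))
  refine exists_exponent_lt_eight (A := B) (C := C) hk ?_
  rw [reverse_mul_of_domain] at hR
  have := dvd_sub hR (hB.mul_left A.reverse)
  convert this using 1
  ring

theorem geom_eq (n : ℕ) (u : (ZMod 2)[X]) : u * geom n (1 + u) = (1 + u) ^ n + 1 := by
  have h := geom_mul n (1 + u)
  rw [add_sub_cancel_left, CharTwo.sub_eq_add] at h
  rw [mul_comm, h]

theorem reverse_mersenne_sq {a b : ℕ} :
    ((1 + X) ^ b + X ^ (a + b) : (ZMod 2)[X]) ^ 2 = (1 + X) ^ (2 * b) + X ^ (2 * (a + b)) := by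
  rw [CharTwo.add_sq]; ring

theorem isCoprime_X_pow (k b : ℕ) : IsCoprime (X ^ k : (ZMod 2)[X]) ((1 + X) ^ b) :=
  IsCoprime.pow ⟨-1, 1, by ring⟩

/-- The reverse of `geom n M` is, up to a power of `1 + x`, that of `M` modulo `x ^ (2 deg M)`, because
`u * geom n (1 + u) = (1 + u) ^ n + 1` and `M ^ 2` has reverse `(1 + x) ^ (2 b) + x ^ (2 deg M)`. -/
theorem reverse_geom {a b : ℕ} (ha : 0 < a) {k : ℕ} (hk : k ≤ 2 * (a + b)) {n : ℕ}
    (hn : Odd n) (hn1 : 1 < n) :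
    ∃ C, X ^ k ∣ (geom n (1 + X ^ a * (X + 1) ^ b)).reverse - (1 + X) ^ C * ((1 + X) ^ b + X ^ (a + b)) := by
  obtain ⟨h, rfl⟩ := hn
  have h1 := congrArg reverse (geom_eq (2 * h + 1) (X ^ a * (X + 1) ^ b))
  rw [reverse_mul_of_domain, reverse_X_pow_mul_X_add_one_pow, reverse_add_one, reverse_pow,
    reverse_mersenne, natDegree_pow, (monic_mersenne (R := ZMod 2) (by omega)).2, pow_succ,
    pow_mul, reverse_mersenne_sq] at h1
  set G := (geom (2 * h + 1) (1 + X ^ a * (X + 1) ^ b)).reverse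
  refine ⟨2 * b * h - b, (isCoprime_X_pow k b).dvd_of_dvd_mul_left ?_⟩
  have hC : (1 + X : (ZMod 2)[X]) ^ b * (1 + X) ^ (2 * b * h - b) = ((1 + X) ^ (2 * b)) ^ h := by
    rw [← pow_add, ← pow_mul]; congr 1
    have : b * 1 ≤ b * h := Nat.mul_le_mul_left b (by omega)
    have : 2 * b * h = b * h + b * h := by ring
    omega
  have h2 : X ^ k ∣ (((1 + X) ^ (2 * b) + X ^ (2 * (a + b))) ^ h - ((1 + X) ^ (2 * b)) ^ h : (ZMod 2)[X]) := by
    refine dvd_trans ?_ (sub_dvd_pow_sub_pow _ _ h)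
    rw [add_sub_cancel_left]
    exact pow_dvd_pow _ hk
  have h3 : X ^ k ∣ (X ^ ((2 * h + 1) * (a + b)) : (ZMod 2)[X]) :=
    pow_dvd_pow _ (hk.trans (Nat.mul_le_mul_right _ (by omega)))
  have := dvd_add (h2.mul_right ((1 + X) ^ b + X ^ (a + b))) h3
  convert this using 1
  linear_combination h1 - ((1 + X) ^ b + X ^ (a + b)) * hC

theorem coeff_one_add_X_pow_mul (e j c : ℕ) :
    ((1 + X) ^ e * X ^ j : (ZMod 2)[X]).coeff c = if j ≤ c then ((e.choose (c - j) : ℕ) : ZMod 2) else 0 := by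
  rw [coeff_mul_X_pow']
  simp only [coeff_one_add_X_pow]

/-! ### Impossible expansions -/

/-- The lemmas named `no_expansion_*` exclude the conclusion of `exists_expansion` for particular `A` and
`R`, by comparing a few low coefficients for each of the eight exponents. Here `A = M₁`. -/
theorem no_expansion_geom_three {E : ℕ} (hE : E < 8) :
    ¬ X ^ 4 ∣ ((1 + X) ^ E * ((1 + X) ^ 1 + X ^ 2) - 1 : (ZMod 2)[X]) := by
  intro h
  have e : ((1 + X) ^ E * ((1 + X) ^ 1 + X ^ 2) - 1 : (ZMod 2)[X]) =
      ((1 + X) ^ (E + 1) * X ^ 0 + (1 + X) ^ (E + 0) * X ^ 2)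
      - ((1 + X) ^ 0 * X ^ 0) := by ring
  rw [e, X_pow_dvd_iff] at h
  have h1 := h 1 (by norm_num)
  have h2 := h 2 (by norm_num)
  have h3 := h 3 (by norm_num)
  simp only [coeff_add, coeff_sub, coeff_one_add_X_pow_mul] at h1 h2 h3
  revert h1 h2 h3
  interval_cases E <;> decide

theorem no_expansion_M1_one {E : ℕ} (hE : E < 8) :
    ¬ X ^ 4 ∣ ((1 + X) ^ E * 1
      - ((1 + X) ^ 1 + X ^ 2) : (ZMod 2)[X]) := by
  intro h
  have e : ((1 + X) ^ E * 1 - ((1 + X) ^ 1 + X ^ 2) : (ZMod 2)[X]) =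
      ((1 + X) ^ (E + 0) * X ^ 0)
      - ((1 + X) ^ 1 * X ^ 0 + (1 + X) ^ 0 * X ^ 2) := by ring
  rw [e, X_pow_dvd_iff] at h
  have h1 := h 1 (by norm_num)
  have h2 := h 2 (by norm_num)
  have h3 := h 3 (by norm_num)
  simp only [coeff_add, coeff_sub, coeff_one_add_X_pow_mul] at h1 h2 h3
  revert h1 h2 h3
  interval_cases E <;> decide

theorem no_expansion_M1_cubics {E : ℕ} (hE : E < 8) :
    ¬ X ^ 4 ∣ ((1 + X) ^ E * (((1 + X) ^ 2 + X ^ 3) * ((1 + X) ^ 1 + X ^ 3))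
      - ((1 + X) ^ 1 + X ^ 2) : (ZMod 2)[X]) := by
  intro h
  have e : ((1 + X) ^ E * (((1 + X) ^ 2 + X ^ 3) * ((1 + X) ^ 1 + X ^ 3)) - ((1 + X) ^ 1 + X ^ 2) : (ZMod 2)[X]) =
      ((1 + X) ^ (E + 3) * X ^ 0 + (1 + X) ^ (E + 1) * X ^ 3 + (1 + X) ^ (E + 2) * X ^ 3 + (1 + X) ^ (E + 0) * X ^ 6)
      - ((1 + X) ^ 1 * X ^ 0 + (1 + X) ^ 0 * X ^ 2) := by ring
  rw [e, X_pow_dvd_iff] at h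
  have h1 := h 1 (by norm_num)
  have h2 := h 2 (by norm_num)
  have h3 := h 3 (by norm_num)
  simp only [coeff_add, coeff_sub, coeff_one_add_X_pow_mul] at h1 h2 h3
  revert h1 h2 h3
  interval_cases E <;> decide

theorem no_expansion_M3_one {E : ℕ} (hE : E < 8) :
    ¬ X ^ 6 ∣ ((1 + X) ^ E * 1
      - ((1 + X) ^ 3 + X ^ 4) : (ZMod 2)[X]) := by
  intro h
  have e : ((1 + X) ^ E * 1 - ((1 + X) ^ 3 + X ^ 4) : (ZMod 2)[X]) =
      ((1 + X) ^ (E + 0) * X ^ 0)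
      - ((1 + X) ^ 3 * X ^ 0 + (1 + X) ^ 0 * X ^ 4) := by ring
  rw [e, X_pow_dvd_iff] at h
  have h1 := h 1 (by norm_num)
  have h2 := h 2 (by norm_num)
  have h3 := h 3 (by norm_num)
  have h4 := h 4 (by norm_num)
  have h5 := h 5 (by norm_num)
  simp only [coeff_add, coeff_sub, coeff_one_add_X_pow_mul] at h1 h2 h3 h4 h5
  revert h1 h2 h3 h4 h5
  interval_cases E <;> decide

theorem no_expansion_M3_cubics {E : ℕ} (hE : E < 8) :
    ¬ X ^ 6 ∣ ((1 + X) ^ E * (((1 + X) ^ 2 + X ^ 3) * ((1 + X) ^ 1 + X ^ 3))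
      - ((1 + X) ^ 3 + X ^ 4) : (ZMod 2)[X]) := by
  intro h
  have e : ((1 + X) ^ E * (((1 + X) ^ 2 + X ^ 3) * ((1 + X) ^ 1 + X ^ 3)) - ((1 + X) ^ 3 + X ^ 4) : (ZMod 2)[X]) =
      ((1 + X) ^ (E + 3) * X ^ 0 + (1 + X) ^ (E + 1) * X ^ 3 + (1 + X) ^ (E + 2) * X ^ 3 + (1 + X) ^ (E + 0) * X ^ 6)
      - ((1 + X) ^ 3 * X ^ 0 + (1 + X) ^ 0 * X ^ 4) := by ring
  rw [e, X_pow_dvd_iff] at h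
  have h1 := h 1 (by norm_num)
  have h2 := h 2 (by norm_num)
  have h3 := h 3 (by norm_num)
  have h4 := h 4 (by norm_num)
  have h5 := h 5 (by norm_num)
  simp only [coeff_add, coeff_sub, coeff_one_add_X_pow_mul] at h1 h2 h3 h4 h5
  revert h1 h2 h3 h4 h5
  interval_cases E <;> decide

theorem no_expansion_M2_one {E : ℕ} (hE : E < 8) :
    ¬ X ^ 4 ∣ ((1 + X) ^ E * 1 - ((1 + X) ^ 2 + X ^ 3) : (ZMod 2)[X]) := by
  intro h
  have e : ((1 + X) ^ E * 1 - ((1 + X) ^ 2 + X ^ 3) : (ZMod 2)[X]) =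
      ((1 + X) ^ (E + 0) * X ^ 0)
      - ((1 + X) ^ 2 * X ^ 0 + (1 + X) ^ 0 * X ^ 3) := by ring
  rw [e, X_pow_dvd_iff] at h
  have h1 := h 1 (by norm_num)
  have h2 := h 2 (by norm_num)
  have h3 := h 3 (by norm_num)
  simp only [coeff_add, coeff_sub, coeff_one_add_X_pow_mul] at h1 h2 h3
  revert h1 h2 h3
  interval_cases E <;> decide

theorem no_expansion_sextic_one {E : ℕ} (hE : E < 8) :
    ¬ X ^ 8 ∣ ((1 + X) ^ E * 1 - (1 + X ^ 6) : (ZMod 2)[X]) := by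
  intro h
  have e : ((1 + X) ^ E * 1 - (1 + X ^ 6) : (ZMod 2)[X]) =
      ((1 + X) ^ (E + 0) * X ^ 0)
      - ((1 + X) ^ 0 * X ^ 0 + (1 + X) ^ 0 * X ^ 6) := by ring
  rw [e, X_pow_dvd_iff] at h
  have h1 := h 1 (by norm_num)
  have h2 := h 2 (by norm_num)
  have h4 := h 4 (by norm_num)
  have h6 := h 6 (by norm_num)
  have h7 := h 7 (by norm_num)
  simp only [coeff_add, coeff_sub, coeff_one_add_X_pow_mul] at h1 h2 h4 h6 h7
  revert h1 h2 h4 h6 h7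
  interval_cases E <;> decide

theorem no_expansion_sextic_left {E : ℕ} (hE : E < 8) :
    ¬ X ^ 8 ∣ ((1 + X) ^ E * ((1 + X) ^ 5 + X ^ 6) - (1 + X ^ 6) : (ZMod 2)[X]) := by
  intro h
  have e : ((1 + X) ^ E * ((1 + X) ^ 5 + X ^ 6) - (1 + X ^ 6) : (ZMod 2)[X]) =
      ((1 + X) ^ (E + 5) * X ^ 0 + (1 + X) ^ (E + 0) * X ^ 6)
      - ((1 + X) ^ 0 * X ^ 0 + (1 + X) ^ 0 * X ^ 6) := by ring
  rw [e, X_pow_dvd_iff] at h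
  have h1 := h 1 (by norm_num)
  have h2 := h 2 (by norm_num)
  have h4 := h 4 (by norm_num)
  have h6 := h 6 (by norm_num)
  have h7 := h 7 (by norm_num)
  simp only [coeff_add, coeff_sub, coeff_one_add_X_pow_mul] at h1 h2 h4 h6 h7
  revert h1 h2 h4 h6 h7
  interval_cases E <;> decide

theorem no_expansion_sextic_right {E : ℕ} (hE : E < 8) :
    ¬ X ^ 8 ∣ ((1 + X) ^ E * ((1 + X) ^ 1 + X ^ 6) - (1 + X ^ 6) : (ZMod 2)[X]) := by
  intro h
  have e : ((1 + X) ^ E * ((1 + X) ^ 1 + X ^ 6) - (1 + X ^ 6) : (ZMod 2)[X]) =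
      ((1 + X) ^ (E + 1) * X ^ 0 + (1 + X) ^ (E + 0) * X ^ 6)
      - ((1 + X) ^ 0 * X ^ 0 + (1 + X) ^ 0 * X ^ 6) := by ring
  rw [e, X_pow_dvd_iff] at h
  have h1 := h 1 (by norm_num)
  have h2 := h 2 (by norm_num)
  have h4 := h 4 (by norm_num)
  have h6 := h 6 (by norm_num)
  have h7 := h 7 (by norm_num)
  simp only [coeff_add, coeff_sub, coeff_one_add_X_pow_mul] at h1 h2 h4 h6 h7
  revert h1 h2 h4 h6 h7
  interval_cases E <;> decide

theorem no_expansion_sextic_both {E : ℕ} (hE : E < 8) :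
    ¬ X ^ 8 ∣ ((1 + X) ^ E * (((1 + X) ^ 5 + X ^ 6) * ((1 + X) ^ 1 + X ^ 6)) - (1 + X ^ 6) : (ZMod 2)[X]) := by
  intro h
  have e : ((1 + X) ^ E * (((1 + X) ^ 5 + X ^ 6) * ((1 + X) ^ 1 + X ^ 6)) - (1 + X ^ 6) : (ZMod 2)[X]) =
      ((1 + X) ^ (E + 6) * X ^ 0 + (1 + X) ^ (E + 1) * X ^ 6 + (1 + X) ^ (E + 5) * X ^ 6 + (1 + X) ^ (E + 0) * X ^ 12)
      - ((1 + X) ^ 0 * X ^ 0 + (1 + X) ^ 0 * X ^ 6) := by ring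
  rw [e, X_pow_dvd_iff] at h
  have h1 := h 1 (by norm_num)
  have h2 := h 2 (by norm_num)
  have h4 := h 4 (by norm_num)
  have h6 := h 6 (by norm_num)
  have h7 := h 7 (by norm_num)
  simp only [coeff_add, coeff_sub, coeff_one_add_X_pow_mul] at h1 h2 h4 h6 h7
  revert h1 h2 h4 h6 h7
  interval_cases E <;> decide

/-! ### Small Mersenne primes and counting irreducibles -/

theorem isMersennePrime_two_le {P : (ZMod 2)[X]} (hP : IsMersennePrime P) : 2 ≤ P.natDegree := by
  obtain ⟨-, a, b, ha, hb, rfl⟩ := hP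
  rw [(monic_mersenne (by omega)).2]
  omega

theorem eq_of_natDegree_two {P : (ZMod 2)[X]} (hP : IsMersennePrime P) (h : P.natDegree = 2) :
    P = 1 + X ^ 1 * (X + 1) ^ 1 := by
  obtain ⟨-, a, b, ha, hb, rfl⟩ := hP
  rw [(monic_mersenne (by omega)).2] at h
  obtain ⟨rfl, rfl⟩ : a = 1 ∧ b = 1 := by omega
  rfl

theorem eq_of_natDegree_three {P : (ZMod 2)[X]} (hP : IsMersennePrime P) (h : P.natDegree = 3) :
    P = 1 + X ^ 1 * (X + 1) ^ 2 ∨ P = 1 + X ^ 2 * (X + 1) ^ 1 := by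
  obtain ⟨-, a, b, ha, hb, rfl⟩ := hP
  rw [(monic_mersenne (by omega)).2] at h
  obtain ⟨rfl, rfl⟩ | ⟨rfl, rfl⟩ : (a = 1 ∧ b = 2) ∨ (a = 2 ∧ b = 1) := by omega
  exacts [.inl rfl, .inr rfl]

theorem eq_of_natDegree_four {P : (ZMod 2)[X]} (hP : IsMersennePrime P) (h : P.natDegree = 4) :
    P = 1 + X ^ 1 * (X + 1) ^ 3 ∨ P = 1 + X ^ 3 * (X + 1) ^ 1 := by
  obtain ⟨hi, a, b, ha, hb, rfl⟩ := hP
  rw [(monic_mersenne (by omega)).2] at h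
  obtain ⟨rfl, rfl⟩ | ⟨rfl, rfl⟩ | ⟨rfl, rfl⟩ :
      (a = 1 ∧ b = 3) ∨ (a = 2 ∧ b = 2) ∨ (a = 3 ∧ b = 1) := by omega
  exacts [.inl rfl, absurd ⟨even_two, even_two⟩ (exponents_not_even hi), .inr rfl]

theorem eq_of_natDegree_six {P : (ZMod 2)[X]} (hP : IsMersennePrime P) (h : P.natDegree = 6) :
    P = 1 + X ^ 1 * (X + 1) ^ 5 ∨ P = 1 + X ^ 5 * (X + 1) ^ 1 := by
  obtain ⟨hi, a, b, ha, hb, rfl⟩ := hP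
  rw [(monic_mersenne (by omega)).2] at h
  obtain ⟨rfl, rfl⟩ | ⟨rfl, rfl⟩ | ⟨rfl, rfl⟩ | ⟨rfl, rfl⟩ | ⟨rfl, rfl⟩ :
      (a = 1 ∧ b = 5) ∨ (a = 2 ∧ b = 4) ∨ (a = 3 ∧ b = 3) ∨ (a = 4 ∧ b = 2) ∨ (a = 5 ∧ b = 1) := by omega
  · exact .inl rfl
  · exact absurd ⟨by decide, by decide⟩ (exponents_not_even hi)
  · -- `1 + v ^ 3 = (1 + v) (1 + v + v ^ 2)` with `v = x (x + 1)`
    exfalso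
    have h2 : (1 + X ^ 3 * (X + 1) ^ 3 : (ZMod 2)[X])
        = (1 + X ^ 1 * (X + 1) ^ 1) * (1 + X ^ 1 * (X + 1) ^ 1 + X ^ 2 * (X + 1) ^ 2) := by
      linear_combination (-(X * (X + 1) + X ^ 2 * (X + 1) ^ 2)) * (CharTwo.two_eq_zero : (2 : (ZMod 2)[X]) = 0)
    have h0 : (1 + X ^ 1 * (X + 1) ^ 1 : (ZMod 2)[X]).natDegree = 2 := (monic_mersenne (by omega)).2
    have h9 : (1 + X ^ 3 * (X + 1) ^ 3 : (ZMod 2)[X]).natDegree = 6 := (monic_mersenne (by omega)).2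
    rw [h2] at hi h9
    have h1 := natDegree_mul (left_ne_zero_of_mul hi.ne_zero) (right_ne_zero_of_mul hi.ne_zero)
    rw [h0, h9] at h1
    rcases of_irreducible_mul hi with h3 | h3
    · have := natDegree_eq_zero_of_isUnit h3; omega
    · have := natDegree_eq_zero_of_isUnit h3; omega
  · exact absurd ⟨by decide, by decide⟩ (exponents_not_even hi)
  · exact .inr rfl

theorem irreducible_mersenne {a b : ℕ} (ha : 0 < a) (hb : 0 < b) (hab : a + b ≤ 3) :
    Irreducible (1 + X ^ a * (X + 1) ^ b : (ZMod 2)[X]) := by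
  have hd := (monic_mersenne (R := ZMod 2) (a := a) (b := b) (by omega)).2
  refine irreducible_of_degree_le_three_of_not_isRoot (by rw [hd, Finset.mem_Icc]; omega) fun x => ?_
  rw [IsRoot]
  simp only [eval_add, eval_one, eval_mul, eval_pow, eval_X]
  revert x
  have : ∀ x : ZMod 2, x = 0 ∨ x + 1 = 0 := by decide
  intro x
  rcases this x with h | h <;> simp [h, ha.ne', hb.ne']

theorem not_dvd_of_dvd_geom {P M : (ZMod 2)[X]} {n : ℕ} (hn : 0 < n) (hP : Irreducible P)
    (h : P ∣ geom n M) : ¬ P ∣ M := by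
  intro h1
  have h2 := dvd_sub (h1.trans (dvd_pow_self M hn.ne')) (geom_mul n M ▸ h.mul_right (M - 1))
  rw [sub_sub_cancel] at h2
  exact hP.not_isUnit (isUnit_of_dvd_one h2)

/-- Every irreducible polynomial of degree `m ≥ 2` other than `M` divides `σ (M ^ (2 ^ m - 2))`. -/
theorem dvd_geom_of_natDegree_eq {P : (ZMod 2)[X]} (hP : Irreducible P) {a b : ℕ}
    (hM : Irreducible (1 + X ^ a * (X + 1) ^ b : (ZMod 2)[X])) (hne : P ≠ 1 + X ^ a * (X + 1) ^ b)
    (hd : 2 ≤ P.natDegree) : P ∣ geom (2 ^ P.natDegree - 1) (1 + X ^ a * (X + 1) ^ b) := by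
  refine dvd_geom_mersenne hP (fun h => hne (eq_of_irreducible_of_dvd hP hM h)) fun h => ?_
  rw [add_sub_cancel_left] at h
  rcases eq_X_or_of_dvd hP h with rfl | rfl
  · simp at hd
  · have : (X + 1 : (ZMod 2)[X]).natDegree = 1 := natDegree_X_add_C 1
    omega

theorem mersenne_ne {b c d : ℕ} (hc : 2 ≤ c) :
    (1 + X ^ 1 * (X + 1) ^ b : (ZMod 2)[X]) ≠ 1 + X ^ c * (X + 1) ^ d := by
  intro h
  have h2 : (X * (X + 1) ^ b : (ZMod 2)[X]) = X * (X ^ (c - 1) * (X + 1) ^ d) := by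
    rw [← mul_assoc, ← pow_succ', Nat.sub_add_cancel (by omega)]
    simpa using h
  have h3 := congrArg (eval 0) (mul_left_cancel₀ X_ne_zero h2)
  simp [show c - 1 ≠ 0 by omega] at h3

/-- `bar M₃` does not divide `σ (M₃ ^ 4)`; they are coprime. -/
theorem not_dvd_geom_five : ¬ (1 + X ^ 3 * (X + 1) ^ 1 : (ZMod 2)[X]) ∣ geom 5 (1 + X ^ 1 * (X + 1) ^ 3) := by
  rintro ⟨c, hc⟩
  have hg : geom 5 (1 + X ^ 1 * (X + 1) ^ 3 : (ZMod 2)[X]) = 1 + (1 + X ^ 1 * (X + 1) ^ 3)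
      + (1 + X ^ 1 * (X + 1) ^ 3) ^ 2 + (1 + X ^ 1 * (X + 1) ^ 3) ^ 3 + (1 + X ^ 1 * (X + 1) ^ 3) ^ 4 := by
    simp [geom, Finset.sum_range_succ]
  rw [hg] at hc
  -- Bézout coefficients of the two (coprime) polynomials
  have h : (1 + X ^ 3 * (X + 1) ^ 1 : (ZMod 2)[X]) *
      ((X + X ^ 3 + X ^ 5 + X ^ 6 + X ^ 7 + X ^ 9 + X ^ 13) + (1 + X) * c) = 1 := by
    linear_combination (-(1 + X)) * hc +
      (2 + 8 * X + 25 * X ^ 2 + 68 * X ^ 3 + 151 * X ^ 4 + 300 * X ^ 5 + 515 * X ^ 6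
        + 774 * X ^ 7 + 1023 * X ^ 8 + 1175 * X ^ 9 + 1159 * X ^ 10 + 971 * X ^ 11
        + 669 * X ^ 12 + 361 * X ^ 13 + 143 * X ^ 14 + 39 * X ^ 15 + 7 * X ^ 16 + X ^ 17) *
        (CharTwo.two_eq_zero : (2 : (ZMod 2)[X]) = 0)
  have h1 := natDegree_eq_zero_of_isUnit (IsUnit.of_mul_eq_one _ h)
  rw [(monic_mersenne (by omega)).2] at h1
  omega

theorem not_dvd_one_add_mul_sq : ¬ (1 + X ^ 2 * (X + 1) ^ 1 : (ZMod 2)[X]) ∣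
    1 + X ^ 1 * (X + 1) ^ 2 * (1 + X ^ 1 * (X + 1) ^ 2) ^ 2 := by
  rintro ⟨c, hc⟩
  -- Bézout coefficients, as in `not_dvd_geom_five`
  have h : (1 + X ^ 2 * (X + 1) ^ 1 : (ZMod 2)[X]) * ((X ^ 3 + X ^ 8) + (1 + X + X ^ 2) * c) = 1 := by
    linear_combination (-(1 + X + X ^ 2)) * hc +
      (X + 3 * X ^ 2 + 8 * X ^ 3 + 16 * X ^ 4 + 26 * X ^ 5 + 32 * X ^ 6 + 30 * X ^ 7
        + 22 * X ^ 8 + 11 * X ^ 9 + 4 * X ^ 10 + X ^ 11) *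
        (CharTwo.two_eq_zero : (2 : (ZMod 2)[X]) = 0)
  have h1 := natDegree_eq_zero_of_isUnit (IsUnit.of_mul_eq_one _ h)
  rw [(monic_mersenne (by omega)).2] at h1
  omega

theorem isCoprime_of_ne {P Q : (ZMod 2)[X]} (hP : Irreducible P) (hQ : Irreducible Q) (h : P ≠ Q) :
    IsCoprime P Q :=
  hP.coprime_iff_not_dvd.mpr fun hd => h (eq_of_irreducible_of_dvd hP hQ hd)

theorem two_add_mul_lt_two_pow {m : ℕ} (h5 : 5 ≤ m) : 2 + (m - 1) * m < 2 ^ m := by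
  obtain ⟨k, rfl⟩ := Nat.exists_eq_add_of_le h5
  have e : 5 + k - 1 = 4 + k := by omega
  rw [e]
  clear h5 e
  induction k with
  | zero => norm_num
  | succ k ih =>
    rw [← add_assoc 4, ← add_assoc 5, pow_succ]
    nlinarith

/-- The `m - 1` polynomials `1 + x^a (x+1)^(m-a)` have at most `m (m - 1) < 2 ^ m - 2` roots in the field of
`2 ^ m` elements; the minimal polynomial of any other element outside `𝔽₂` has degree `m`. -/
theorem exists_irreducible_not_mersenne {m : ℕ} (hm : m.Prime) (h5 : 5 ≤ m) :
    ∃ P : (ZMod 2)[X], Irreducible P ∧ P.natDegree = m ∧ ¬ IsMersennePrime P := by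
  classical
  let K := GaloisField 2 m
  have hcard : Nat.card K = 2 ^ m := GaloisField.card 2 m hm.ne_zero
  have : Fintype K := Fintype.ofFinite K
  let S : Finset K := {0, 1} ∪ (Finset.Icc 1 (m - 1)).biUnion fun a =>
    (1 + X ^ a * (X + 1) ^ (m - a) : K[X]).roots.toFinset
  have hS : S.card < Fintype.card K := by
    rw [← Nat.card_eq_fintype_card, hcard]
    have h1 : ((Finset.Icc 1 (m - 1)).biUnion fun a =>
        (1 + X ^ a * (X + 1) ^ (m - a) : K[X]).roots.toFinset).card ≤ (m - 1) * m := by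
      refine (Finset.card_biUnion_le_card_mul _ _ m fun a ha => ?_).trans (by simp)
      rw [Finset.mem_Icc] at ha
      refine (Multiset.toFinset_card_le _).trans ((card_roots' _).trans ?_)
      rw [(monic_mersenne (by omega)).2]
      omega
    have h2 : S.card ≤ 2 + (m - 1) * m := (Finset.card_union_le _ _).trans (add_le_add Finset.card_le_two h1)
    refine h2.trans_lt ?_
    exact two_add_mul_lt_two_pow h5
  obtain ⟨α, hα⟩ : ∃ α, α ∉ S := by
    by_contra! h
    exact hS.not_ge (Finset.card_le_card fun x _ => h x)
  simp only [S, Finset.mem_union, Finset.mem_insert, Finset.mem_singleton, Finset.mem_biUnion, not_or,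
    not_exists, not_and] at hα
  obtain ⟨⟨h0, h1⟩, hr⟩ := hα
  have hint : IsIntegral (ZMod 2) α := Algebra.IsIntegral.isIntegral α
  have hirr := minpoly.irreducible hint
  have hdeg : (minpoly (ZMod 2) α).natDegree = m := by
    have hd : (minpoly (ZMod 2) α).natDegree ∣ m := by
      have := minpoly.degree_dvd (K := ZMod 2) (x := α) hint
      rwa [GaloisField.finrank 2 hm.ne_zero] at this
    rcases (Nat.dvd_prime hm).mp hd with h | h
    · exfalso
      rw [minpoly.natDegree_eq_one_iff] at h
      obtain ⟨c, hc⟩ := h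
      have : ∀ c : ZMod 2, c = 0 ∨ c = 1 := by decide
      rcases this c with rfl | rfl
      · exact h0 (by simpa using hc.symm)
      · exact h1 (by simpa using hc.symm)
    · exact h
  refine ⟨_, hirr, hdeg, ?_⟩
  rintro ⟨-, a, b, ha, hb, h⟩
  have hab : a + b = m := by rw [← hdeg, h, (monic_mersenne (by omega)).2]
  refine hr a (Finset.mem_Icc.mpr ⟨ha, by omega⟩) ?_
  rw [Multiset.mem_toFinset, mem_roots (monic_mersenne (by omega)).1.ne_zero, IsRoot]
  have h2 := minpoly.aeval (ZMod 2) α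
  rw [h] at h2
  rw [show m - a = b by omega]
  simpa using h2

/-! ### Conjugation and the cases `p = 3`, `M₁`, `M₃` -/

theorem hasNonMersennePrimeFactor_of_not {W : (ZMod 2)[X]}
    (h : (∀ P, Irreducible P → P ∣ W → IsMersennePrime P) → False) :
    HasNonMersennePrimeFactor W := by
  by_contra hc
  refine h fun P hP hPW => ?_
  by_contra hn
  exact hc ⟨P, hP, hPW, hn⟩

theorem HasNonMersennePrimeFactor.of_dvd {V W : (ZMod 2)[X]} (h : HasNonMersennePrimeFactor V) (hVW : V ∣ W) :
    HasNonMersennePrimeFactor W :=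
  let ⟨P, hP, hPV, hn⟩ := h
  ⟨P, hP, hPV.trans hVW, hn⟩

theorem natDegree_mersenne {a b : ℕ} (h : 0 < a + b) : (1 + X ^ a * (X + 1) ^ b : (ZMod 2)[X]).natDegree = a + b :=
  (monic_mersenne h).2

/-- Here `M₁ ∣ 1 + M + M²` is the only prime factor of degree less than `4`. -/
theorem hasNonMersennePrimeFactor_geom_three {a b : ℕ} (ha : 0 < a) (hb : 0 < b) (hab : 4 ≤ a + b)
    (hM : Irreducible (1 + X ^ a * (X + 1) ^ b : (ZMod 2)[X])) :
    HasNonMersennePrimeFactor (geom 3 (1 + X ^ a * (X + 1) ^ b)) := by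
  refine hasNonMersennePrimeFactor_of_not fun h => ?_
  have hsq := squarefree_geom (n := 3) ⟨hM, a, b, ha, hb, rfl⟩ (by decide)
  have h2 : (1 + X ^ 1 * (X + 1) ^ 1 : (ZMod 2)[X]).natDegree = 2 := natDegree_mersenne (by omega)
  have hdvd := dvd_geom_of_natDegree_eq (irreducible_mersenne one_pos one_pos (by norm_num)) hM
    (fun e => by have := congrArg natDegree e; rw [h2, natDegree_mersenne (by omega)] at this; omega)
    h2.ge
  rw [h2] at hdvd
  obtain ⟨C, hC⟩ := reverse_geom (b := b) ha (k := 4) (by omega) (n := 3) (by decide) (by norm_num)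
  obtain ⟨E, hE, hX⟩ := exists_expansion (k := 4) (C := C + b) (R := 1) (by norm_num) hsq hdvd h (by
    intro P hP hPW
    have h3 := dvd_two_pow_natDegree_sub_one hP Nat.prime_three (by norm_num) hPW
    by_contra! hc
    obtain ⟨hc1, hc2⟩ := hc
    have hP0 := hP.natDegree_pos
    interval_cases hd : P.natDegree
    · omega
    · rw [eq_of_natDegree_two (h P hP hPW) hd] at hc1
      exact hc1 dvd_rfl
    · omega) (by
    have := dvd_add hC (((pow_dvd_pow (X : (ZMod 2)[X]) hab).mul_left ((1 + X) ^ C)))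
    convert this using 1
    ring)
  rw [reverse_mersenne] at hX
  exact no_expansion_geom_three hE hX

theorem hasNonMersennePrimeFactor_geom_mersenne {M : (ZMod 2)[X]} {m : ℕ} (hM : IsMersennePrime M)
    (hm : m.Prime) (h5 : 5 ≤ m) : HasNonMersennePrimeFactor (geom (2 ^ m - 1) M) := by
  obtain ⟨P, hP, rfl, hn⟩ := exists_irreducible_not_mersenne hm h5
  have hM' := hM
  obtain ⟨hMi, a, b, ha, hb, rfl⟩ := hM
  exact ⟨P, hP, dvd_geom_of_natDegree_eq hP hMi (fun e => hn (e ▸ hM')) (by omega), hn⟩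

theorem bar_bar (S : (ZMod 2)[X]) : bar (bar S) = S := by
  have h : (X + 1 : (ZMod 2)[X]).comp (X + 1) = X := by
    simp only [add_comp, X_comp, one_comp]
    rw [add_assoc, CharTwo.add_self_eq_zero, add_zero]
  rw [bar, bar, comp_assoc, h, comp_X]

theorem bar_mersenne (a b : ℕ) : bar (1 + X ^ a * (X + 1) ^ b) = 1 + X ^ b * (X + 1) ^ a := by
  have h : (X + 1 + 1 : (ZMod 2)[X]) = X := by
    rw [add_assoc, CharTwo.add_self_eq_zero, add_zero]
  simp [bar, h, mul_comm]

theorem bar_dvd {A B : (ZMod 2)[X]} (h : A ∣ B) : bar A ∣ bar B :=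
  (compRingHom (X + 1 : (ZMod 2)[X])).map_dvd h

theorem irreducible_bar {P : (ZMod 2)[X]} (h : Irreducible P) : Irreducible (bar P) := by
  have := (MulEquiv.irreducible_iff (algEquivAevalXAddC (1 : ZMod 2))).mpr h
  simpa [bar, comp, aeval_def, eval₂_eq_eval_map] using this

theorem IsMersennePrime.bar {P : (ZMod 2)[X]} (h : IsMersennePrime P) : IsMersennePrime (bar P) := by
  obtain ⟨hi, a, b, ha, hb, rfl⟩ := h
  exact ⟨irreducible_bar hi, b, a, hb, ha, bar_mersenne a b⟩

theorem bar_geom (n : ℕ) (M : (ZMod 2)[X]) : bar (geom n M) = geom n (bar M) := by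
  have h := map_sum (compRingHom (X + 1 : (ZMod 2)[X])) (fun i => M ^ i) (Finset.range n)
  simp only [map_pow, coe_compRingHom_apply] at h
  exact h

theorem HasNonMersennePrimeFactor.geom_bar {n : ℕ} {M : (ZMod 2)[X]}
    (h : HasNonMersennePrimeFactor (geom n M)) : HasNonMersennePrimeFactor (geom n (bar M)) := by
  obtain ⟨Q, hQ, hQd, hn⟩ := h
  refine ⟨bar Q, irreducible_bar hQ, bar_geom n M ▸ bar_dvd hQd, fun h => hn ?_⟩
  rw [← bar_bar Q]
  exact h.bar

theorem mersenne_mul_dvd {W : (ZMod 2)[X]} {b c d : ℕ} (hc : 2 ≤ c)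
    (h1 : Irreducible (1 + X ^ 1 * (X + 1) ^ b : (ZMod 2)[X]))
    (h2 : Irreducible (1 + X ^ c * (X + 1) ^ d : (ZMod 2)[X]))
    (h1W : (1 + X ^ 1 * (X + 1) ^ b : (ZMod 2)[X]) ∣ W) (h2W : (1 + X ^ c * (X + 1) ^ d : (ZMod 2)[X]) ∣ W) :
    ((1 + X ^ 1 * (X + 1) ^ b) * (1 + X ^ c * (X + 1) ^ d) : (ZMod 2)[X]) ∣ W :=
  (isCoprime_of_ne h1 h2 (mersenne_ne hc)).mul_dvd h1W h2W

theorem reverse_one_eq : (1 : (ZMod 2)[X]).reverse = 1 := by simpa using reverse_C (1 : ZMod 2)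

/-- As `M₁` is invariant under conjugation, its two cubic candidates `M₂` and `bar M₂` divide `geom n M₁`
together or not at all; there are no other factors of degree less than `4`. -/
theorem hasNonMersennePrimeFactor_geom_M1 {n : ℕ} (hn : Odd n) (hn1 : 1 < n) :
    HasNonMersennePrimeFactor (geom n (1 + X ^ 1 * (X + 1) ^ 1)) := by
  refine hasNonMersennePrimeFactor_of_not fun h => ?_
  have hM := irreducible_mersenne one_pos one_pos (by norm_num)
  have hM2 := irreducible_mersenne one_pos two_pos (by norm_num)
  have hM2' := irreducible_mersenne two_pos one_pos (by norm_num)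
  have hsq := squarefree_geom (n := n) ⟨hM, 1, 1, one_pos, one_pos, rfl⟩ hn
  obtain ⟨C, hC⟩ := reverse_geom (b := 1) one_pos (k := 4) (by omega) hn hn1
  have hsmall : ∀ P, Irreducible P → P ∣ geom n (1 + X ^ 1 * (X + 1) ^ 1) →
      P = 1 + X ^ 1 * (X + 1) ^ 2 ∨ P = 1 + X ^ 2 * (X + 1) ^ 1 ∨ 4 ≤ P.natDegree := by
    intro P hP hPW
    by_contra! hc
    obtain ⟨hc1, hc2, hc3⟩ := hc
    have hP0 := isMersennePrime_two_le (h P hP hPW)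
    interval_cases hd : P.natDegree
    · have := eq_of_natDegree_two (h P hP hPW) hd
      rw [this] at hP hPW
      exact not_dvd_of_dvd_geom hn.pos hP hPW dvd_rfl
    · rcases eq_of_natDegree_three (h P hP hPW) hd with e | e
      exacts [hc1 e, hc2 e]
  by_cases hd : (1 + X ^ 1 * (X + 1) ^ 2 : (ZMod 2)[X]) ∣ geom n (1 + X ^ 1 * (X + 1) ^ 1)
  · have hd2 := bar_dvd hd
    rw [bar_geom, bar_mersenne, bar_mersenne] at hd2
    obtain ⟨E, hE, hX⟩ := exists_expansion (k := 4) (C := C) (by norm_num) hsq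
      (mersenne_mul_dvd le_rfl hM2 hM2' hd hd2) h (by
        intro P hP hPW
        rcases hsmall P hP hPW with rfl | rfl | e
        exacts [.inl (dvd_mul_right _ _), .inl (dvd_mul_left _ _), .inr e]) hC
    rw [reverse_mul_of_domain, reverse_mersenne, reverse_mersenne] at hX
    exact no_expansion_M1_cubics hE hX
  · obtain ⟨E, hE, hX⟩ := exists_expansion (k := 4) (C := C) (by norm_num) hsq
      (one_dvd _) h (by
        intro P hP hPW
        rcases hsmall P hP hPW with rfl | rfl | e
        · exact absurd hPW hd
        · have hd2 := bar_dvd hPW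
          rw [bar_geom, bar_mersenne, bar_mersenne] at hd2
          exact absurd hd2 hd
        · exact .inr e) hC
    rw [reverse_one_eq] at hX
    exact no_expansion_M1_one hE hX

/-- For `p ≠ 3, 31` the Mersenne prime factors of degree less than `6` are `M₂` and
`bar M₂` if `p = 7`, and none otherwise. -/
theorem hasNonMersennePrimeFactor_geom_M3 (hM : Irreducible (1 + X ^ 1 * (X + 1) ^ 3 : (ZMod 2)[X])) {p : ℕ}
    (hp : p.Prime) (hp2 : p ≠ 2) :
    HasNonMersennePrimeFactor (geom p (1 + X ^ 1 * (X + 1) ^ 3)) := by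
  have hMP : IsMersennePrime (1 + X ^ 1 * (X + 1) ^ 3 : (ZMod 2)[X]) :=
    ⟨hM, 1, 3, by norm_num, by norm_num, rfl⟩
  by_cases hp3 : p = 3
  · subst hp3
    exact hasNonMersennePrimeFactor_geom_three one_pos three_pos (by norm_num) hM
  -- `2` has order `5` modulo `31`, so quintic factors would appear below
  by_cases hp31 : p = 31
  · subst hp31
    exact hasNonMersennePrimeFactor_geom_mersenne (m := 5) hMP (by norm_num) le_rfl
  refine hasNonMersennePrimeFactor_of_not fun h => ?_
  have hodd := hp.odd_of_ne_two hp2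
  have hsq := squarefree_geom (n := p) hMP hodd
  have hd4 : (1 + X ^ 1 * (X + 1) ^ 3 : (ZMod 2)[X]).natDegree = 4 := natDegree_mersenne (by omega)
  have hM2 := irreducible_mersenne one_pos two_pos (by norm_num)
  have hM2' := irreducible_mersenne two_pos one_pos (by norm_num)
  obtain ⟨C, hC⟩ := reverse_geom (b := 3) one_pos (k := 6) (by omega) hodd hp.one_lt
  have hdeg : ∀ P, Irreducible P → P ∣ geom p (1 + X ^ 1 * (X + 1) ^ 3) →
      6 ≤ P.natDegree ∨ (P.natDegree = 3 ∧ p = 7) := by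
    intro P hP hPW
    have h3 := dvd_two_pow_natDegree_sub_one hP hp hp2 hPW
    by_contra! hc
    obtain ⟨hc1, hc2⟩ := hc
    have hP0 := isMersennePrime_two_le (h P hP hPW)
    interval_cases hd : P.natDegree
    · exact hp3 ((Nat.prime_dvd_prime_iff_eq hp Nat.prime_three).mp h3)
    · exact hc2 rfl ((Nat.prime_dvd_prime_iff_eq hp (by norm_num)).mp h3)
    · have h15 : p ∣ 3 * 5 := h3
      rcases hp.dvd_mul.mp h15 with h15 | h15
      · exact hp3 ((Nat.prime_dvd_prime_iff_eq hp Nat.prime_three).mp h15)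
      · have hp5 := (Nat.prime_dvd_prime_iff_eq hp Nat.prime_five).mp h15
        subst hp5
        rcases eq_of_natDegree_four (h P hP hPW) hd with e | e
        · exact not_dvd_of_dvd_geom (by norm_num) hP hPW (e ▸ dvd_rfl)
        · exact not_dvd_geom_five (e ▸ hPW)
    · exact hp31 ((Nat.prime_dvd_prime_iff_eq hp (by norm_num)).mp h3)
  by_cases hp7 : p = 7
  · have h1 : (1 + X ^ 1 * (X + 1) ^ 2 : (ZMod 2)[X]).natDegree = 3 := natDegree_mersenne (by omega)
    have h2 : (1 + X ^ 2 * (X + 1) ^ 1 : (ZMod 2)[X]).natDegree = 3 := natDegree_mersenne (by omega)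
    have hd1 := dvd_geom_of_natDegree_eq hM2 hM (fun e => by
      have := congrArg natDegree e; rw [h1, hd4] at this; omega) (by omega)
    have hd2 := dvd_geom_of_natDegree_eq hM2' hM (fun e => by
      have := congrArg natDegree e; rw [h2, hd4] at this; omega) (by omega)
    rw [h1] at hd1
    rw [h2] at hd2
    have e7 : 2 ^ 3 - 1 = p := by rw [hp7]; norm_num
    rw [e7] at hd1 hd2
    obtain ⟨E, hE, hX⟩ := exists_expansion (k := 6) (C := C) (by norm_num) hsq
      (mersenne_mul_dvd le_rfl hM2 hM2' hd1 hd2) h (by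
        intro P hP hPW
        rcases hdeg P hP hPW with e | ⟨e, -⟩
        · exact .inr e
        · rcases eq_of_natDegree_three (h P hP hPW) e with rfl | rfl
          exacts [.inl (dvd_mul_right _ _), .inl (dvd_mul_left _ _)]) hC
    rw [reverse_mul_of_domain, reverse_mersenne, reverse_mersenne] at hX
    exact no_expansion_M3_cubics hE hX
  · obtain ⟨E, hE, hX⟩ := exists_expansion (k := 6) (C := C) (by norm_num) hsq
      (one_dvd _) h (fun P hP hPW => .inr ((hdeg P hP hPW).resolve_right fun e => hp7 e.2)) hC
    rw [reverse_one_eq] at hX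
    exact no_expansion_M3_one hE hX

/-- A Mersenne prime of degree `6` is `1 + x (x+1)^5` or its conjugate, so only four products `A` have to be
compared with `1 + x ^ 6` modulo `x ^ 8`. -/
theorem not_all_mersenne_of_reverse {W : (ZMod 2)[X]} (hW : Squarefree W) {C : ℕ}
    (h : ∀ P, Irreducible P → P ∣ W → IsMersennePrime P)
    (hdeg : ∀ P, Irreducible P → P ∣ W → P.natDegree = 6 ∨ 8 ≤ P.natDegree)
    (hR : X ^ 8 ∣ W.reverse - (1 + X) ^ C * (1 + X ^ 6)) : False := by
  have hsmall : ∀ P, Irreducible P → P ∣ W →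
      P = 1 + X ^ 1 * (X + 1) ^ 5 ∨ P = 1 + X ^ 5 * (X + 1) ^ 1 ∨ 8 ≤ P.natDegree := by
    intro P hP hPW
    rcases hdeg P hP hPW with e | e
    · rcases eq_of_natDegree_six (h P hP hPW) e with e | e
      exacts [.inl e, .inr (.inl e)]
    · exact .inr (.inr e)
  have key : ∀ A, A ∣ W → (∀ P, Irreducible P → P ∣ W →
      P = 1 + X ^ 1 * (X + 1) ^ 5 ∨ P = 1 + X ^ 5 * (X + 1) ^ 1 → P ∣ A) →
      ∃ E < 8, X ^ 8 ∣ (1 + X) ^ E * A.reverse - (1 + X ^ 6) := by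
    intro A hA hAP
    refine exists_expansion (k := 8) (C := C) le_rfl hW hA h (fun P hP hPW => ?_) hR
    rcases hsmall P hP hPW with e | e | e
    exacts [.inl (hAP P hP hPW (.inl e)), .inl (hAP P hP hPW (.inr e)), .inr e]
  by_cases h5 : Irreducible (1 + X ^ 1 * (X + 1) ^ 5 : (ZMod 2)[X]) ∧ (1 + X ^ 1 * (X + 1) ^ 5 : (ZMod 2)[X]) ∣ W
  · by_cases h1 : Irreducible (1 + X ^ 5 * (X + 1) ^ 1 : (ZMod 2)[X]) ∧ (1 + X ^ 5 * (X + 1) ^ 1 : (ZMod 2)[X]) ∣ W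
    · obtain ⟨E, hE, hX⟩ := key _ (mersenne_mul_dvd (by norm_num) h5.1 h1.1 h5.2 h1.2) (by
        rintro P - - (rfl | rfl)
        exacts [dvd_mul_right _ _, dvd_mul_left _ _])
      rw [reverse_mul_of_domain, reverse_mersenne, reverse_mersenne] at hX
      exact no_expansion_sextic_both hE hX
    · obtain ⟨E, hE, hX⟩ := key _ h5.2 (by
        rintro P hP hPW (rfl | rfl)
        exacts [dvd_rfl, absurd ⟨hP, hPW⟩ h1])
      rw [reverse_mersenne] at hX
      exact no_expansion_sextic_left hE hX
  · by_cases h1 : Irreducible (1 + X ^ 5 * (X + 1) ^ 1 : (ZMod 2)[X]) ∧ (1 + X ^ 5 * (X + 1) ^ 1 : (ZMod 2)[X]) ∣ W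
    · obtain ⟨E, hE, hX⟩ := key _ h1.2 (by
        rintro P hP hPW (rfl | rfl)
        exacts [absurd ⟨hP, hPW⟩ h5, dvd_rfl])
      rw [reverse_mersenne] at hX
      exact no_expansion_sextic_right hE hX
    · obtain ⟨E, hE, hX⟩ := key _ (one_dvd W) (by
        rintro P hP hPW (rfl | rfl)
        exacts [absurd ⟨hP, hPW⟩ h5, absurd ⟨hP, hPW⟩ h1])
      rw [reverse_one_eq] at hX
      exact no_expansion_sextic_one hE hX

/-! ### The case `M₂`, orders divisible by 8, and the theorem -/

theorem one_add_X_pow_four : (1 + X : (ZMod 2)[X]) ^ 4 = 1 + X ^ 4 := by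
  rw [show 4 = 2 ^ 2 by norm_num, add_pow_char_pow, one_pow]

/-- With `M = M₂ = 1 + u`, the divisor `1 + M² + M³ = 1 + u M²` of `geom 7 M` has factors of degree divisible by
`3`, and the only cubic candidates, `M₂` and `bar M₂`, do not divide it. -/
theorem hasNonMersennePrimeFactor_geom_seven : HasNonMersennePrimeFactor (geom 7 (1 + X ^ 1 * (X + 1) ^ 2)) := by
  have h20 : (2 : (ZMod 2)[X]) = 0 := CharTwo.two_eq_zero
  have hM2 := irreducible_mersenne one_pos two_pos (by norm_num)
  have hMP : IsMersennePrime (1 + X ^ 1 * (X + 1) ^ 2 : (ZMod 2)[X]) :=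
    ⟨hM2, 1, 2, by norm_num, by norm_num, rfl⟩
  have hd3 : (1 + X ^ 1 * (X + 1) ^ 2 : (ZMod 2)[X]).natDegree = 3 := natDegree_mersenne (by omega)
  set M : (ZMod 2)[X] := 1 + X ^ 1 * (X + 1) ^ 2 with hM
  set Q : (ZMod 2)[X] := 1 + X ^ 1 * (X + 1) ^ 2 * M ^ 2 with hQ
  have hQd : Q ∣ geom 7 M := by
    refine ⟨1 + M + M ^ 3, ?_⟩
    have hQ' : Q = 1 + M ^ 3 - M ^ 2 := by rw [hQ, hM]; ring
    rw [hQ']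
    simp only [geom, Finset.sum_range_succ, Finset.sum_range_zero]
    linear_combination (M ^ 2 * (1 + M + M ^ 3) - M ^ 3) * h20
  refine HasNonMersennePrimeFactor.of_dvd (hasNonMersennePrimeFactor_of_not fun h => ?_) hQd
  refine not_all_mersenne_of_reverse (C := 6)
    ((squarefree_geom (n := 7) hMP (by decide)).squarefree_of_dvd hQd) h ?_ ?_
  · intro P hP hPQ
    have h7 := dvd_two_pow_natDegree_sub_one hP (by norm_num) (by norm_num) (hPQ.trans hQd)
    by_contra! hc
    obtain ⟨hc1, hc2⟩ := hc
    have hP0 := hP.natDegree_pos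
    interval_cases hd : P.natDegree <;> (try norm_num at h7) <;> (try norm_num at hc1)
    rcases eq_of_natDegree_three (h P hP hPQ) hd with e | e
    · exact not_dvd_of_dvd_geom (by norm_num) hP (hPQ.trans hQd) (e ▸ dvd_rfl)
    · exact not_dvd_one_add_mul_sq (e ▸ hPQ)
  · have hu : (X ^ 1 * (X + 1) ^ 2 * M ^ 2).natDegree = 9 := by
      have h0 : (X ^ 1 * (X + 1) ^ 2 : (ZMod 2)[X]) ≠ 0 :=
        ne_zero_of_natDegree_gt (n := 0) (by rw [natDegree_X_pow_mul]; norm_num)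
      rw [natDegree_mul h0 (pow_ne_zero _ hM2.ne_zero), natDegree_pow, hd3, natDegree_X_pow_mul]
    rw [hQ, add_comm, reverse_add_one, hu, reverse_mul_of_domain, reverse_X_pow_mul_X_add_one_pow, reverse_pow,
      hM, reverse_mersenne, reverse_mersenne_sq]
    refine ⟨X - X ^ 2 * (1 + X) ^ 2, ?_⟩
    linear_combination (-(1 + X) ^ 2 * X ^ 6) * one_add_X_pow_four

/-- The factors of `1 + M³ + M⁶` have degree divisible by `6`, the order of `2` modulo `9`. -/
theorem hasNonMersennePrimeFactor_geom_nine : HasNonMersennePrimeFactor (geom 9 (1 + X ^ 1 * (X + 1) ^ 2)) := by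
  have h20 : (2 : (ZMod 2)[X]) = 0 := CharTwo.two_eq_zero
  have hM2 := irreducible_mersenne one_pos two_pos (by norm_num)
  have hMP : IsMersennePrime (1 + X ^ 1 * (X + 1) ^ 2 : (ZMod 2)[X]) :=
    ⟨hM2, 1, 2, by norm_num, by norm_num, rfl⟩
  have hd3 : (1 + X ^ 1 * (X + 1) ^ 2 : (ZMod 2)[X]).natDegree = 3 := natDegree_mersenne (by omega)
  set M : (ZMod 2)[X] := 1 + X ^ 1 * (X + 1) ^ 2 with hM
  set Q : (ZMod 2)[X] := M ^ 3 * (M ^ 3 + 1) + 1 with hQ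
  have hQd : Q ∣ geom 9 M := by
    refine ⟨1 + M + M ^ 2, ?_⟩
    rw [hQ]
    simp only [geom, Finset.sum_range_succ, Finset.sum_range_zero]
    ring
  refine HasNonMersennePrimeFactor.of_dvd (hasNonMersennePrimeFactor_of_not fun h => ?_) hQd
  refine not_all_mersenne_of_reverse (C := 12)
    ((squarefree_geom (n := 9) hMP (by decide)).squarefree_of_dvd hQd) h ?_ ?_
  · intro P hP hPQ
    have h9 := dvd_two_pow_natDegree_sub_one_of_pow (M := M) hP (p := 3) 1 Nat.prime_three (by
        have := hPQ.mul_right (M ^ 3 - 1)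
        convert this using 1
        rw [hQ]; ring) (by
        intro h3
        have h4 := dvd_sub hPQ (h3.mul_right (M ^ 3 + 2))
        have h5 : Q - (M ^ 3 ^ 1 - 1) * (M ^ 3 + 2) = 1 := by rw [hQ]; linear_combination h20
        rw [h5] at h4
        exact hP.not_isUnit (isUnit_of_dvd_one h4))
    by_contra! hc
    obtain ⟨hc1, hc2⟩ := hc
    have hP0 := hP.natDegree_pos
    interval_cases hd : P.natDegree <;> (try norm_num at h9) <;> (try norm_num at hc1)
  · have hne : M ^ 3 + 1 ≠ 0 := by
      intro h0
      have h1 := natDegree_add_C (p := M ^ 3) (a := (1 : ZMod 2))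
      rw [C_1, h0, natDegree_pow, hd3] at h1
      simp at h1
    have hdeg : (M ^ 3 + 1).natDegree = 9 := by
      have h1 := natDegree_add_C (p := M ^ 3) (a := (1 : ZMod 2))
      rw [C_1, natDegree_pow, hd3] at h1
      exact h1
    have hu : (M ^ 3 * (M ^ 3 + 1)).natDegree = 18 := by
      rw [natDegree_mul (pow_ne_zero _ hM2.ne_zero) hne, natDegree_pow, hd3, hdeg]
    rw [hQ, reverse_add_one, hu, reverse_mul_of_domain, reverse_add_one, reverse_pow, natDegree_pow, hd3,
      hM, reverse_mersenne]
    have hR2 := reverse_mersenne_sq (a := 1) (b := 2)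
    set R : (ZMod 2)[X] := (1 + X) ^ 2 + X ^ (1 + 2)
    have hR6 : R ^ 6 = ((1 + X) ^ 4 + X ^ 6) * ((1 + X) ^ 8 + X ^ 12) := by
      have h4 : R ^ 4 = (1 + X) ^ 8 + X ^ 12 := by
        rw [show 4 = 2 * 2 by norm_num, pow_mul, hR2, CharTwo.add_sq]; ring
      rw [show 6 = 2 + 4 by norm_num, pow_add, hR2, h4]
    refine ⟨R ^ 3 * X + X ^ 10 + ((1 + X) ^ 4 + X ^ 6) * X ^ 4 - X ^ 2 * (1 + X) ^ 8, ?_⟩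
    linear_combination hR6 - ((1 + X) ^ 8 * X ^ 6) * one_add_X_pow_four

theorem hasNonMersennePrimeFactor_geom_M2 {n : ℕ} (hn : Odd n) (hn5 : 5 ≤ n) :
    HasNonMersennePrimeFactor (geom n (1 + X ^ 1 * (X + 1) ^ 2)) := by
  by_cases hp : ∃ p, p.Prime ∧ p ∣ n ∧ p ≠ 3
  · obtain ⟨p, hp, hpn, hp3⟩ := hp
    refine HasNonMersennePrimeFactor.of_dvd ?_ (geom_dvd_geom hpn _)
    have hodd : Odd p := hn.of_dvd_nat hpn
    have hp2 : p ≠ 2 := by rintro rfl; revert hodd; decide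
    by_cases hp7 : p = 7
    · subst hp7; exact hasNonMersennePrimeFactor_geom_seven
    refine hasNonMersennePrimeFactor_of_not fun h => ?_
    have hM2 := irreducible_mersenne one_pos two_pos (by norm_num)
    have hsq := squarefree_geom (n := p) ⟨hM2, 1, 2, one_pos, two_pos, rfl⟩ hodd
    obtain ⟨C, hC⟩ := reverse_geom (b := 2) one_pos (k := 4) (by omega) hodd hp.one_lt
    obtain ⟨E, hE, hX⟩ := exists_expansion (k := 4) (C := C) (by norm_num) hsq (one_dvd _) h (by
      intro P hP hPW
      have h3 := dvd_two_pow_natDegree_sub_one hP hp hp2 hPW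
      by_contra! hc
      obtain ⟨-, hc2⟩ := hc
      have hP0 := isMersennePrime_two_le (h P hP hPW)
      interval_cases hd : P.natDegree
      · exact hp3 ((Nat.prime_dvd_prime_iff_eq hp Nat.prime_three).mp h3)
      · exact hp7 ((Nat.prime_dvd_prime_iff_eq hp (by norm_num)).mp h3)) hC
    rw [reverse_one_eq] at hX
    exact no_expansion_M2_one hE hX
  · push Not at hp
    have h3 := Nat.eq_prime_pow_of_unique_prime_dvd (n := n) (p := 3) (by omega) fun {d} hd hdn => hp d hd hdn
    have h9 : 9 ∣ n := by
      rw [h3]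
      refine pow_dvd_pow 3 (m := 2) ?_
      by_contra! hc
      interval_cases n.primeFactorsList.length <;> omega
    exact hasNonMersennePrimeFactor_geom_nine.of_dvd (geom_dvd_geom h9 _)

/-- All factors of `geom p M` have degree divisible by the order of `2` modulo `p`, hence by `8`. -/
theorem hasNonMersennePrimeFactor_geom_of_eight_dvd {M : (ZMod 2)[X]}
    (hM : IsMersennePrime M) {p : ℕ} (hp : p.Prime)
    (hp2 : p ≠ 2) (h8 : 8 ∣ orderOf (2 : ZMod p)) : HasNonMersennePrimeFactor (geom p M) := by
  have hsq := squarefree_geom hM (hp.odd_of_ne_two hp2)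
  have hnu : ¬ IsUnit (geom p M) := by
    intro hu
    have h1 : geom p M = 1 := eq_of_associated hsq.ne_zero (associated_one_iff_isUnit.mpr hu)
    have h2 := geom_mul p M
    rw [h1, one_mul] at h2
    have h3 := congrArg natDegree (sub_left_injective h2)
    rw [natDegree_pow] at h3
    have := isMersennePrime_two_le hM
    have := hp.two_le
    nlinarith
  obtain ⟨P, hP, hPW⟩ := WfDvdMonoid.exists_irreducible_factor hnu hsq.ne_zero
  refine ⟨P, hP, hPW, ?_⟩
  have h1 := dvd_two_pow_natDegree_sub_one hP hp hp2 hPW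
  have h2 : orderOf (2 : ZMod p) ∣ P.natDegree := by
    rw [orderOf_dvd_iff_pow_eq_one, ← sub_eq_zero]
    have := (ZMod.natCast_eq_zero_iff _ _).mpr h1
    rwa [Nat.cast_sub Nat.one_le_two_pow, Nat.cast_pow, Nat.cast_ofNat, Nat.cast_one] at this
  rintro ⟨hi, a, b, ha, hb, rfl⟩
  rw [natDegree_mersenne (by omega)] at h2
  exact not_irreducible_of_eight_dvd ha hb (h8.trans h2) hi

/-- The order of `2` modulo `2 ^ 2 ^ k + 1` is `2 ^ (k + 1)`. -/
theorem eight_dvd_orderOf_two {p k : ℕ} (hpk : p = Nat.fermatNumber k) (h5 : 5 < p) :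
    8 ∣ orderOf (2 : ZMod p) := by
  have hk : 2 ≤ k := by
    by_contra! hc
    interval_cases k <;> simp [Nat.fermatNumber] at hpk <;> omega
  have hm1 : (2 : ZMod p) ^ 2 ^ k = -1 := by
    have h0 : ((Nat.fermatNumber k : ℕ) : ZMod p) = 0 := by rw [← hpk, ZMod.natCast_self]
    rw [eq_neg_iff_add_eq_zero, ← h0, Nat.fermatNumber]
    push_cast
    rfl
  have : Fact (2 < p) := ⟨by omega⟩
  rw [orderOf_eq_prime_pow (p := 2) (n := k) (x := (2 : ZMod p))]
  · exact pow_dvd_pow 2 (m := 3) (by omega)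
  · rw [hm1]; exact ZMod.neg_one_ne_one
  · rw [pow_succ, pow_mul, hm1]; ring

theorem mersennePoly_eq (j : ℕ) : mersennePoly j = 1 + X ^ 1 * (X + 1) ^ j := by
  rw [mersennePoly, pow_one]


theorem hasNonMersennePrimeFactor_sigma_small {h : ℕ} {M : (ZMod 2)[X]} (hh : 0 < h)
    (hM : IsMersennePrime M)
    (hcase : (M = mersennePoly 1 ∨ M = mersennePoly 3 ∨ M = bar (mersennePoly 3)) ∨
      ((M = mersennePoly 2 ∨ M = bar (mersennePoly 2)) ∧ 2 ≤ h)) :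
    HasNonMersennePrimeFactor (sigma (M ^ (2 * h))) := by
  have hodd : Odd (2 * h + 1) := odd_two_mul_add_one h
  rw [sigma_pow hM.1]
  change HasNonMersennePrimeFactor (geom (2 * h + 1) M)
  have h3 : Irreducible (mersennePoly 3) →
      HasNonMersennePrimeFactor (geom (2 * h + 1) (mersennePoly 3)) := by
    intro hi
    obtain ⟨p, hp, hpn⟩ := Nat.exists_prime_and_dvd (n := 2 * h + 1) (by omega)
    rw [mersennePoly_eq] at hi ⊢
    exact (hasNonMersennePrimeFactor_geom_M3 hi hp (by rintro rfl; omega)).of_dvd (geom_dvd_geom hpn _)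
  rcases hcase with (rfl | rfl | rfl) | ⟨rfl | rfl, h2⟩
  · rw [mersennePoly_eq]
    exact hasNonMersennePrimeFactor_geom_M1 hodd (by omega)
  · exact h3 hM.1
  · exact (h3 (bar_bar (mersennePoly 3) ▸ irreducible_bar hM.1)).geom_bar
  · rw [mersennePoly_eq]
    exact hasNonMersennePrimeFactor_geom_M2 hodd (by omega)
  · rw [mersennePoly_eq]
    exact (hasNonMersennePrimeFactor_geom_M2 hodd (by omega)).geom_bar

theorem hasNonMersennePrimeFactor_sigma_large {h : ℕ} {M : (ZMod 2)[X]}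
    (hM : IsMersennePrime M) (hMs : M ∉ smallMersenne)
    (hcase : ∃ p : ℕ, p.Prime ∧ p ∣ 2 * h + 1 ∧
      ((p ≠ 7 ∧ ∃ m : ℕ, p = mersenne m) ∨ 8 ∣ orderOf (2 : ZMod p))) :
    HasNonMersennePrimeFactor (sigma (M ^ (2 * h))) := by
  rw [sigma_pow hM.1]
  change HasNonMersennePrimeFactor (geom (2 * h + 1) M)
  obtain ⟨p, hp, hpn, hcase⟩ := hcase
  refine HasNonMersennePrimeFactor.of_dvd ?_ (geom_dvd_geom hpn M)
  rcases hcase with ⟨h7, m, rfl⟩ | h8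
  · have hm := hp.of_mersenne
    by_cases hm5 : 5 ≤ m
    · exact hasNonMersennePrimeFactor_geom_mersenne hM hm hm5
    · have hm2 := hm.two_le
      interval_cases m
      · obtain ⟨hi, a, b, ha, hb, rfl⟩ := hM
        refine hasNonMersennePrimeFactor_geom_three ha hb ?_ hi
        by_contra! hc
        refine hMs ?_
        simp only [smallMersenne, mersennePoly_eq, bar_mersenne, Set.mem_insert_iff, Set.mem_singleton_iff]
        obtain ⟨rfl, rfl⟩ | ⟨rfl, rfl⟩ | ⟨rfl, rfl⟩ :
            (a = 1 ∧ b = 1) ∨ (a = 1 ∧ b = 2) ∨ (a = 2 ∧ b = 1) := by omega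
        · exact .inl rfl
        · exact .inr (.inl rfl)
        · exact .inr (.inr (.inl rfl))
      · exact absurd rfl h7
      · exact absurd hm (by norm_num)
  · exact hasNonMersennePrimeFactor_geom_of_eight_dvd hM hp (by rintro rfl; omega) h8

end F2Poly

theorem theorem1p3 :
    (∀ (h : ℕ) (M : Polynomial (ZMod 2)), 0 < h → F2Poly.IsMersennePrime M →
      ((M = F2Poly.mersennePoly 1 ∨ M = F2Poly.mersennePoly 3 ∨
            M = F2Poly.bar (F2Poly.mersennePoly 3)) ∨
          ((M = F2Poly.mersennePoly 2 ∨ M = F2Poly.bar (F2Poly.mersennePoly 2)) ∧ 2 ≤ h) →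
        F2Poly.HasNonMersennePrimeFactor (F2Poly.sigma (M ^ (2 * h)))) ∧
      (M ∉ F2Poly.smallMersenne →
        (∃ p : ℕ, p.Prime ∧ p ∣ 2 * h + 1 ∧
          ((p ≠ 7 ∧ ∃ m : ℕ, p = mersenne m) ∨ 8 ∣ orderOf (2 : ZMod p))) →
        F2Poly.HasNonMersennePrimeFactor (F2Poly.sigma (M ^ (2 * h))))) ∧
    (∀ p : ℕ, p.Prime → (∃ k : ℕ, p = Nat.fermatNumber k) → 5 < p →
      8 ∣ orderOf (2 : ZMod p)) := by
  exact ⟨fun _ _ hh hM => ⟨F2Poly.hasNonMersennePrimeFactor_sigma_small hh hM,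
    F2Poly.hasNonMersennePrimeFactor_sigma_large hM⟩,
    fun _ _ ⟨_, hk⟩ h5 => F2Poly.eight_dvd_orderOf_two hk h5⟩
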